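/- Let $M\ge 0$ be an integer, $\gamma\in\mathbb R$ and $s>0$. On the $M$-mode Hilbert space $L^2(\mathbb R^M)$ let $\hat x_k$ (multiplication by $x_k$) and $\hat p_k=-i\,\partial_{x_k}$, $k=1,\dots,M$, be the quadratures, so $[\hat x_k,\hat p_l]=i\delta_{kl}$. Let $|\gamma\rangle_s$ be the finitely squeezed cubic phase state, i.e. the single-mode state with wave function $$\frac{e^{i\gamma x^3}\,e^{-x^2/(2s^2)}}{\sqrt s\,\pi^{1/4}},$$ and let $\sigma=(|\gamma\rangle_s\langle\gamma|_s)^{\otimes M}$. For a density operator $\rho$ write $F(\sigma,\rho)=\operatorname{Tr}(\sigma\rho)$. Define, on Schwartz space, $$\mathcal W=\Bigl(1+\frac M2\Bigr)\mathbb 1-\sum_{k=1}^{M}w_k,$$ $$w_k=\frac1{2s^2}\hat x_k^2+\frac{s^2}{2}\bigl(9\gamma^2\hat x_k^4+\hat p_k^2+2\gamma\hat p_k^3\bigr)+\frac{s^2}{2}\gamma\bigl((\hat x_k-\hat p_k)^3-(\hat x_k+\hat p_k)^3\bigr).$$ Then $\sigma$ is a density operator and $\mathcal W$ is a fidelity witness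 for $\sigma$: $\mathcal W$ is Hermitian (symmetric on Schwartz space); $\operatorname{Tr}(\mathcal W\rho)\le F(\sigma,\rho)$ for every density operator $\rho$ on $L^2(\mathbb R^M)$; and $\operatorname{Tr}(\mathcal W\sigma)=1=F(\sigma,\sigma)$. Here $\operatorname{Tr}(\mathcal W\rho)=\sum_i q(\rho^{1/2}e_i)\in[-\infty,\infty)$ for any orthonormal basis $(e_i)$, where $q$ is the closed quadratic form of $\mathcal W$ (the upper semicontinuous extension to $L^2(\mathbb R^M)$ of $\eta\mapsto\langle\eta,\mathcal W\eta\rangle$, $\eta$ Schwartz, equal to $-\infty$ off the form domain). Moreover $\mathcal W$ is accessible by homodyne detection alone: it is a real linear combination of $\mathbb 1$ and of at most $6M$ operators, each a power with exponent at most $4$ of a single-mode quadrature $\cos\theta\,\hat x_k+\sin\theta\,\hat p_k$, with at most four phases $\theta$ for each mode $k$. -/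

import Mathlib

open MeasureTheory Filter Topology
open scoped InnerProductSpace ENNReal SchwartzMap

noncomputable section

namespace CVWitness

/-- Configuration space of `M` modes. -/
abbrev Conf (M : ℕ) : Type := EuclideanSpace ℝ (Fin M)

/-- The Hilbert space `L²(ℝ^M)` of `M` modes (`M = 0` gives `ℂ`). -/
abbrev ModeSpace (M : ℕ) : Type := Lp ℂ 2 (volume : Measure (Conf M))

/-- Schwartz space: the common invariant domain of all polynomials in the quadratures. -/
abbrev TestSpace (M : ℕ) : Type := 𝓢(Conf M, ℂ)

/-- A (possibly unbounded) operator given on Schwartz space, leaving it invariant. The ring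
structure (sum, composition, powers) is that of endomorphisms. -/
abbrev Op (M : ℕ) : Type := TestSpace M →L[ℂ] TestSpace M

/-- A Schwartz function as a vector of the Hilbert space. -/
def ket {M : ℕ} (η : TestSpace M) : ModeSpace M := η.toLp 2 volume

/-! ### Quadratures -/

/-- Position operator of mode `k`: `(x̂_k η)(x) = x_k η(x)`. -/
def X {M : ℕ} (k : Fin M) : Op M :=
  SchwartzMap.smulLeftCLM ℂ (fun x : Conf M => ((x k : ℝ) : ℂ))

/-- Momentum operator of mode `k`: `p̂_k η = -i ∂_k η`. -/
def P {M : ℕ} (k : Fin M) : Op M :=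
  (-Complex.I) • LineDeriv.lineDerivOpCLM ℂ (TestSpace M) (EuclideanSpace.single k (1 : ℝ))

theorem X_apply {M : ℕ} (k : Fin M) (η : TestSpace M) (x : Conf M) :
    X k η x = ((x k : ℝ) : ℂ) * η x := by
  have h : (fun x : Conf M => ((x k : ℝ) : ℂ)).HasTemperateGrowth :=
    (Complex.ofRealCLM.comp (EuclideanSpace.proj k : Conf M →L[ℝ] ℝ)).hasTemperateGrowth
  simp [X, SchwartzMap.smulLeftCLM_apply_apply h]

theorem P_apply {M : ℕ} (k : Fin M) (η : TestSpace M) (x : Conf M) :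
    P k η x = -Complex.I * lineDeriv ℝ η x (EuclideanSpace.single k (1 : ℝ)) := by
  simp [P, SchwartzMap.lineDerivOp_apply]

/-- The quadrature of mode `k` at phase `θ`: the observable read out by homodyne detection of
mode `k` with local-oscillator phase `θ`. -/
def quadrature {M : ℕ} (k : Fin M) (θ : ℝ) : Op M :=
  (Real.cos θ : ℂ) • X k + (Real.sin θ : ℂ) • P k

/-! ### The target state -/

/-- Wave function of the finitely squeezed cubic phase state,
`e^{iγx³} e^{-x²/(2s²)} / (√s π^{1/4})`. -/
def cubicPhaseWave (γ s : ℝ) (x : ℝ) : ℂ :=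
  Complex.exp (Complex.I * γ * x ^ 3) * Complex.exp (-x ^ 2 / (2 * s ^ 2)) /
    ((√s * Real.pi ^ (1 / 4 : ℝ) : ℝ) : ℂ)

/-- Wave function of `M` independent copies. -/
def targetWave (γ s : ℝ) (M : ℕ) (x : Conf M) : ℂ := ∏ k, cubicPhaseWave γ s (x k)

theorem memLp_targetWave (γ : ℝ) {s : ℝ} (hs : 0 < s) (M : ℕ) :
    MemLp (targetWave γ s M) 2 (volume : Measure (Conf M)) := by
  have hcont : Continuous (targetWave γ s M) := by
    unfold targetWave cubicPhaseWave
    fun_prop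
  rw [memLp_two_iff_integrable_sq_norm hcont.aestronglyMeasurable]
  set A : ℝ := √s * Real.pi ^ (1 / 4 : ℝ) with hA
  have hb : 0 < (((1 / s ^ 2 : ℝ) : ℂ)).re := by
    rw [Complex.ofReal_re]; positivity
  have key := (GaussianFourier.integrable_cexp_neg_mul_sq_norm_add hb 0 (0 : Conf M)).norm
  have h1 : ∀ t : ℝ, ‖cubicPhaseWave γ s t‖ ^ 2 = (1 / ‖A‖ ^ 2) * Real.exp (-(t ^ 2 / s ^ 2)) := by
    intro t
    have e1 : ‖Complex.exp (Complex.I * γ * t ^ 3)‖ = 1 := by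
      have : Complex.I * γ * t ^ 3 = ((γ * t ^ 3 : ℝ) : ℂ) * Complex.I := by push_cast; ring
      rw [this, Complex.norm_exp_ofReal_mul_I]
    have e2 : ‖Complex.exp (-(t : ℂ) ^ 2 / (2 * s ^ 2))‖ = Real.exp (-t ^ 2 / (2 * s ^ 2)) := by
      have : (-(t : ℂ) ^ 2 / (2 * s ^ 2)) = ((-t ^ 2 / (2 * s ^ 2) : ℝ) : ℂ) := by push_cast; ring
      rw [this, Complex.norm_exp_ofReal]
    rw [cubicPhaseWave, norm_div, norm_mul, e1, e2, ← hA, Complex.norm_real, one_mul, div_pow,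
      ← Real.exp_nat_mul]
    rw [div_eq_mul_inv, mul_comm, one_div]
    congr 2
    field_simp
    push_cast
    ring
  have h2 : (fun x : Conf M => ‖targetWave γ s M x‖ ^ 2) =
      fun x => (1 / ‖A‖ ^ 2) ^ M *
        ‖Complex.exp (-((1 / s ^ 2 : ℝ) : ℂ) * (‖x‖ : ℂ) ^ 2 + 0 * ((inner ℝ 0 x : ℝ) : ℂ))‖ := by
    funext x
    rw [targetWave, norm_prod, ← Finset.prod_pow]
    simp_rw [h1]
    rw [Finset.prod_mul_distrib, Finset.prod_const, Finset.card_univ, Fintype.card_fin,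
      ← Real.exp_sum]
    congr 1
    have : -((1 / s ^ 2 : ℝ) : ℂ) * (‖x‖ : ℂ) ^ 2 + 0 * ((inner ℝ 0 x : ℝ) : ℂ) =
        ((-(1 / s ^ 2) * ‖x‖ ^ 2 : ℝ) : ℂ) := by push_cast; ring
    rw [this, Complex.norm_exp_ofReal, EuclideanSpace.norm_sq_eq, Finset.mul_sum]
    congr 1
    refine Finset.sum_congr rfl fun i _ => ?_
    rw [Real.norm_eq_abs, sq_abs]
    ring
  rw [h2]
  exact key.const_mul _

/-- The unit vector `|γ⟩_s^{⊗M}`. -/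
def targetVec (γ : ℝ) {s : ℝ} (hs : 0 < s) (M : ℕ) : ModeSpace M :=
  (memLp_targetWave γ hs M).toLp

/-- The target state `σ = (|γ⟩_s⟨γ|_s)^{⊗M}`. -/
def target (γ : ℝ) {s : ℝ} (hs : 0 < s) (M : ℕ) : ModeSpace M →L[ℂ] ModeSpace M :=
  InnerProductSpace.rankOne ℂ (targetVec γ hs M) (targetVec γ hs M)

/-! ### States, traces, fidelity

Traces are computed in an orthonormal basis `e`, over which the theorem quantifies. -/

/-- Density operator: positive, of trace one. -/
def IsDensityOperator {M : ℕ} {ι : Type*} (e : HilbertBasis ι ℂ (ModeSpace M))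
    (ρ : ModeSpace M →L[ℂ] ModeSpace M) : Prop :=
  ρ.IsPositive ∧ HasSum (fun i => ⟪e i, ρ (e i)⟫_ℂ) 1

/-- The (squared) fidelity `F(σ, ρ) = Tr(σρ)` with respect to a pure state `σ`. -/
def fidelity {M : ℕ} {ι : Type*} (e : HilbertBasis ι ℂ (ModeSpace M))
    (σ ρ : ModeSpace M →L[ℂ] ModeSpace M) : ℝ :=
  (∑' i, ⟪e i, σ (ρ (e i))⟫_ℂ).re

/-! ### Expectation values of an unbounded observable -/

/-- `⟨φ, W φ⟩ ∈ [-∞, ∞]` for an arbitrary vector `φ`: the form `η ↦ ⟨η, W η⟩` on Schwartz space,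
extended to all of `L²` by upper semicontinuity. For `W` symmetric and bounded above this is the
closed quadratic form of `W`, with value `-∞` off the form domain. -/
def formValue {M : ℕ} (W : Op M) (φ : ModeSpace M) : EReal :=
  limsup (fun η : TestSpace M => (((⟪ket η, ket (W η)⟫_ℂ).re : ℝ) : EReal)) (comap ket (𝓝 φ))

/-- The positive square root `ρ^{1/2}` of a positive bounded operator. -/
def opSqrt {H : Type*} [NormedAddCommGroup H] [InnerProductSpace ℂ H] [CompleteSpace H]
    (ρ : H →L[ℂ] H) : H →L[ℂ] H :=
  CFC.sqrt ρ

/-- `Tr(Wρ) = Tr(ρ^{1/2} W ρ^{1/2}) = ∑ᵢ ⟨ρ^{1/2}eᵢ, W ρ^{1/2}eᵢ⟩ ∈ [-∞, ∞]`, as the difference of the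
sums of the positive and of the negative parts. -/
def expectation {M : ℕ} {ι : Type*} (e : HilbertBasis ι ℂ (ModeSpace M))
    (W : Op M) (ρ : ModeSpace M →L[ℂ] ModeSpace M) : EReal :=
  ((∑' i, (formValue W (opSqrt ρ (e i))).toENNReal : ℝ≥0∞) : EReal) -
    ((∑' i, (-formValue W (opSqrt ρ (e i))).toENNReal : ℝ≥0∞) : EReal)

/-- Hermitian (symmetric) on Schwartz space. -/
def IsHermitianObservable {M : ℕ} (W : Op M) : Prop :=
  ∀ η ζ : TestSpace M, ⟪ket (W η), ket ζ⟫_ℂ = ⟪ket η, ket (W ζ)⟫_ℂ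

/-- `W` is a fidelity witness for the pure state `σ`: a Hermitian observable with
`Tr(Wρ) ≤ F(σ, ρ)` for all states `ρ`, and `Tr(Wσ) = 1`. -/
structure IsFidelityWitness {M : ℕ} {ι : Type*} (e : HilbertBasis ι ℂ (ModeSpace M))
    (σ : ModeSpace M →L[ℂ] ModeSpace M) (W : Op M) : Prop where
  hermitian : IsHermitianObservable W
  lower_bound : ∀ ρ : ModeSpace M →L[ℂ] ModeSpace M, IsDensityOperator e ρ →
    expectation e W ρ ≤ ((fidelity e σ ρ : ℝ) : EReal)
  tight : expectation e W σ = 1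

/-! ### The witness -/

/-- `w_k`, a polynomial of degree four in `x̂_k` and `p̂_k`. -/
def w (γ s : ℝ) {M : ℕ} (k : Fin M) : Op M :=
  ((1 / (2 * s ^ 2) : ℝ) : ℂ) • X k ^ 2
    + ((s ^ 2 / 2 : ℝ) : ℂ) • ((9 * γ ^ 2 : ℂ) • X k ^ 4 + P k ^ 2 + (2 * γ : ℂ) • P k ^ 3)
    + ((s ^ 2 / 2 * γ : ℝ) : ℂ) • ((X k - P k) ^ 3 - (X k + P k) ^ 3)

/-- `W = (1 + M/2) 𝟙 - ∑_k w_k`. -/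
def witness (γ s : ℝ) (M : ℕ) : Op M :=
  (1 + (M : ℂ) / 2) • (1 : Op M) - ∑ k, w γ s k

/-- `W` is accessible by homodyne detection alone: it is a real linear combination of the identity
and of at most `N` powers, of exponent at most `d`, of single-mode quadratures, with at most `b`
local-oscillator phases used on each mode. -/
def HomodyneMeasurable {M : ℕ} (N d b : ℕ) (W : Op M) : Prop :=
  ∃ (n : ℕ) (c : ℝ) (lam : Fin n → ℝ) (mode : Fin n → Fin M) (phase : Fin n → ℝ)
    (deg : Fin n → ℕ),
    n ≤ N ∧ (∀ i, deg i ≤ d) ∧ (∀ k, {θ | ∃ i, mode i = k ∧ phase i = θ}.ncard ≤ b) ∧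
    W = (c : ℂ) • (1 : Op M) + ∑ i, (lam i : ℂ) • quadrature (mode i) (phase i) ^ deg i

end CVWitness

end

/-! Conjugating the position-momentum pair by the cubic phase gate replaces `p` by `p - 3γx²`, and
squeezing rescales the pair by `s`. The operators `a_k = (x_k/s + i s (p_k - 3γ x_k²))/√2` and their
formal adjoints therefore satisfy the canonical commutation relations, and each `a_k` annihilates
the target vector `ψ`. Expanding `a_k† a_k` gives exactly `w_k - 1/2` (`raising_mul_lowering`), so
`W = 1 - N` with `N = ∑ a_k† a_k` the number operator whose vacuum is `ψ` (`witness_eq`).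

The inequality `W ≤ |ψ⟩⟨ψ|` thus says that `N ≥ 1` on the complement of `ψ`. Algebraically, `n`
creation operators applied to `ψ` give an eigenvector of eigenvalue `n`, or zero. To reach every
Schwartz vector, `norm_sq_le_vacuum_add_number` projects onto finitely many layers, which `N`
preserves, and uses that the excitations of `ψ` are total.

Totality (`targetExcitations_dense`) is the analytic input. The excitations contain all `(t·x)^n ψ`;
if `f` is orthogonal to them, the Gaussian decay of `ψ` lets the exponential series be integrated
termwise, so the Fourier transform of `conj f · ψ` vanishes. Since `ψ` has no zeros, `f = 0`.

The bound passes to the closed form because `φ ↦ |⟨ψ, φ⟩|²` is continuous. Summing it over the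
vectors `ρ^{1/2} e_i` gives `⟨ψ, ρψ⟩`, the fidelity; equality at `σ` comes from `Wψ = ψ`. -/

namespace CVWitness

open scoped ContDiff FourierTransform

/-! ### Abstract bosonic ladder operators and the spectral gap -/

section Ladder

variable {ι D H : Type*} [AddCommGroup D] [Module ℂ D]
  [NormedAddCommGroup H] [InnerProductSpace ℂ H]

/-- The span of the vectors obtained from `ψ` by applying `n` raising operators. -/
def excitationLayer (b : ι → D →ₗ[ℂ] D) (ψ : D) : ℕ → Submodule ℂ D
  | 0 => ℂ ∙ ψ
  | n + 1 => ⨆ k, (excitationLayer b ψ n).map (b k)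

/-- The span of the vectors obtained from `ψ` by applying at most `n` raising operators. -/
def excitationSpace (b : ι → D →ₗ[ℂ] D) (ψ : D) : ℕ → Submodule ℂ D
  | 0 => excitationLayer b ψ 0
  | n + 1 => excitationSpace b ψ n ⊔ excitationLayer b ψ (n + 1)

/-- The number operator. -/
def numberOp [Fintype ι] (a b : ι → D →ₗ[ℂ] D) : D →ₗ[ℂ] D := ∑ k, b k ∘ₗ a k

instance excitationLayer_finite [Finite ι] (b : ι → D →ₗ[ℂ] D) (ψ : D) (n : ℕ) :
    Module.Finite ℂ (excitationLayer b ψ n) := by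
  induction n with
  | zero => rw [excitationLayer]; infer_instance
  | succ n ih => rw [excitationLayer]; infer_instance

instance excitationSpace_finite [Finite ι] (b : ι → D →ₗ[ℂ] D) (ψ : D) (n : ℕ) :
    Module.Finite ℂ (excitationSpace b ψ n) := by
  induction n with
  | zero => rw [excitationSpace]; infer_instance
  | succ n ih => rw [excitationSpace]; infer_instance

theorem excitationSpace_mono (b : ι → D →ₗ[ℂ] D) (ψ : D) : Monotone (excitationSpace b ψ) :=
  monotone_nat_of_le_succ fun _ => le_sup_left

theorem excitationLayer_le_space (b : ι → D →ₗ[ℂ] D) (ψ : D) (n : ℕ) :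
    excitationLayer b ψ n ≤ excitationSpace b ψ n := by
  cases n with
  | zero => exact le_rfl
  | succ n => exact le_sup_right

theorem raising_mem_excitationSpace (b : ι → D →ₗ[ℂ] D) (ψ : D) (k : ι) (n : ℕ) :
    ∀ v ∈ excitationSpace b ψ n, b k v ∈ excitationSpace b ψ (n + 1) := by
  have key : ∀ n, ∀ v ∈ excitationLayer b ψ n, b k v ∈ excitationLayer b ψ (n + 1) := by
    intro n v hv
    exact Submodule.mem_iSup_of_mem k (Submodule.mem_map_of_mem hv)
  induction n with
  | zero => exact fun v hv => excitationLayer_le_space b ψ 1 (key 0 v hv)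
  | succ n ih =>
    intro v hv
    obtain ⟨w, hw, u, hu, rfl⟩ := Submodule.mem_sup.1 hv
    rw [map_add]
    exact add_mem (excitationSpace_mono b ψ (Nat.le_succ _) (ih w hw))
      (excitationLayer_le_space b ψ _ (key _ u hu))

/-- Commuting the lowering operator to the right leaves shorter words, until it meets the vacuum and
gives zero. -/
theorem lowering_mem_excitationSpace [DecidableEq ι] {a b : ι → D →ₗ[ℂ] D} {ψ : D}
    (hab : ∀ k l v, a k (b l v) = b l (a k v) + if k = l then v else 0)
    (hψ : ∀ k, a k ψ = 0) (k : ι) (n : ℕ) :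
    ∀ v ∈ excitationSpace b ψ n, a k v ∈ excitationSpace b ψ n := by
  have key : ∀ n, ∀ v ∈ excitationLayer b ψ n, a k v ∈ excitationSpace b ψ n := by
    intro n
    induction n with
    | zero =>
      intro v hv
      obtain ⟨c, rfl⟩ := Submodule.mem_span_singleton.1 hv
      simp [hψ]
    | succ n ih =>
      suffices h : excitationLayer b ψ (n + 1) ≤ (excitationSpace b ψ (n + 1)).comap (a k) from
        fun v hv => h hv
      refine iSup_le fun l => ?_
      rintro _ ⟨v, hv, rfl⟩
      rw [Submodule.mem_comap, hab]
      refine add_mem (raising_mem_excitationSpace b ψ l n _ (ih v hv)) ?_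
      split_ifs
      · exact excitationSpace_mono b ψ (Nat.le_succ _) (excitationLayer_le_space b ψ _ hv)
      · exact zero_mem _
  induction n with
  | zero => exact key 0
  | succ n ih =>
    intro v hv
    obtain ⟨w, hw, u, hu, rfl⟩ := Submodule.mem_sup.1 hv
    rw [map_add]
    exact add_mem (excitationSpace_mono b ψ (Nat.le_succ _) (ih w hw)) (key _ u hu)

/-- Since `[N, b_l] = b_l`, each raising operator increases the eigenvalue by one. -/
theorem numberOp_of_mem_excitationLayer [Fintype ι] [DecidableEq ι]
    {a b : ι → D →ₗ[ℂ] D} {ψ : D}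
    (hab : ∀ k l v, a k (b l v) = b l (a k v) + if k = l then v else 0)
    (hbb : ∀ k l v, b k (b l v) = b l (b k v))
    (hψ : ∀ k, a k ψ = 0) (n : ℕ) :
    ∀ v ∈ excitationLayer b ψ n, numberOp a b v = (n : ℂ) • v := by
  induction n with
  | zero =>
    intro v hv
    obtain ⟨c, rfl⟩ := Submodule.mem_span_singleton.1 hv
    simp [numberOp, hψ]
  | succ n ih =>
    suffices h : excitationLayer b ψ (n + 1) ≤
        LinearMap.ker (numberOp a b - ((n + 1 : ℕ) : ℂ) • LinearMap.id) by
      intro v hv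
      simpa [sub_eq_zero] using h hv
    refine iSup_le fun l => ?_
    rintro _ ⟨v, hv, rfl⟩
    have h1 : numberOp a b (b l v) = b l (numberOp a b v) + b l v := by
      simp only [numberOp, LinearMap.sum_apply, LinearMap.comp_apply, hab, map_add, map_sum,
        hbb _ l, Finset.sum_add_distrib]
      simp [apply_ite]
    rw [LinearMap.mem_ker, LinearMap.sub_apply, h1, ih v hv, map_smul]
    simp only [LinearMap.smul_apply, LinearMap.id_apply]
    push_cast
    module

theorem inner_numberOp [Fintype ι] {a b : ι → D →ₗ[ℂ] D} {ket : D →ₗ[ℂ] H}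
    (hadj : ∀ k v w, ⟪ket (a k v), ket w⟫_ℂ = ⟪ket v, ket (b k w)⟫_ℂ) (v w : D) :
    ⟪ket v, ket (numberOp a b w)⟫_ℂ = ∑ k, ⟪ket (a k v), ket (a k w)⟫_ℂ := by
  simp [numberOp, map_sum, hadj]

theorem inner_numberOp_comm [Fintype ι] {a b : ι → D →ₗ[ℂ] D} {ket : D →ₗ[ℂ] H}
    (hadj : ∀ k v w, ⟪ket (a k v), ket w⟫_ℂ = ⟪ket v, ket (b k w)⟫_ℂ) (v w : D) :
    ⟪ket (numberOp a b v), ket w⟫_ℂ = ⟪ket v, ket (numberOp a b w)⟫_ℂ := by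
  rw [inner_numberOp hadj, ← inner_conj_symm, inner_numberOp hadj, map_sum]
  simp

/-- Eigenvectors of the symmetric `N` for different eigenvalues are orthogonal. -/
theorem excitationLayer_orthogonal [Fintype ι] [DecidableEq ι]
    {a b : ι → D →ₗ[ℂ] D} {ψ : D} {ket : D →ₗ[ℂ] H}
    (hadj : ∀ k v w, ⟪ket (a k v), ket w⟫_ℂ = ⟪ket v, ket (b k w)⟫_ℂ)
    (hab : ∀ k l v, a k (b l v) = b l (a k v) + if k = l then v else 0)
    (hbb : ∀ k l v, b k (b l v) = b l (b k v))
    (hψ : ∀ k, a k ψ = 0) {m n : ℕ} (hmn : m < n) :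
    ∀ v ∈ excitationSpace b ψ m, ∀ w ∈ excitationLayer b ψ n, ⟪ket v, ket w⟫_ℂ = 0 := by
  have key : ∀ m < n, ∀ v ∈ excitationLayer b ψ m, ∀ w ∈ excitationLayer b ψ n,
      ⟪ket v, ket w⟫_ℂ = 0 := by
    intro m hmn v hv w hw
    have h := inner_numberOp_comm hadj v w
    rw [numberOp_of_mem_excitationLayer hab hbb hψ m v hv,
      numberOp_of_mem_excitationLayer hab hbb hψ n w hw, map_smul, map_smul, inner_smul_left,
      inner_smul_right, Complex.conj_natCast] at h
    have hne : (m : ℂ) - n ≠ 0 := sub_ne_zero.2 (by exact_mod_cast hmn.ne)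
    have h2 : ((m : ℂ) - n) * ⟪ket v, ket w⟫_ℂ = 0 := by linear_combination h
    exact (mul_eq_zero.1 h2).resolve_left hne
  induction m with
  | zero => exact key 0 hmn
  | succ m ih =>
    intro v hv w hw
    obtain ⟨v₁, h₁, v₂, h₂, rfl⟩ := Submodule.mem_sup.1 hv
    rw [map_add, inner_add_left, ih (by omega) v₁ h₁ w hw, key _ hmn v₂ h₂ w hw, add_zero]

/-- Equality holds on multiples of `ψ`. Each further layer is orthogonal to the earlier ones and has
eigenvalue at least one, so it adds at least as much on the right as on the left. Invariance under
`N` is carried along because the cross terms need it. -/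
theorem gap_on_excitationSpace [Fintype ι] [DecidableEq ι]
    {a b : ι → D →ₗ[ℂ] D} {ψ : D} {ket : D →ₗ[ℂ] H}
    (hadj : ∀ k v w, ⟪ket (a k v), ket w⟫_ℂ = ⟪ket v, ket (b k w)⟫_ℂ)
    (hab : ∀ k l v, a k (b l v) = b l (a k v) + if k = l then v else 0)
    (hbb : ∀ k l v, b k (b l v) = b l (b k v))
    (hψ : ∀ k, a k ψ = 0) (hnorm : ‖ket ψ‖ = 1) (n : ℕ) :
    ∀ v ∈ excitationSpace b ψ n, numberOp a b v ∈ excitationSpace b ψ n ∧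
      ‖ket v‖ ^ 2 ≤ ‖⟪ket ψ, ket v⟫_ℂ‖ ^ 2 + (⟪ket v, ket (numberOp a b v)⟫_ℂ).re := by
  induction n with
  | zero =>
    intro v hv
    have h0 := numberOp_of_mem_excitationLayer hab hbb hψ 0 v hv
    simp only [Nat.cast_zero, zero_smul] at h0
    refine ⟨h0 ▸ zero_mem _, ?_⟩
    obtain ⟨c, rfl⟩ := Submodule.mem_span_singleton.1 hv
    rw [h0]
    simp [norm_smul, hnorm, inner_self_eq_norm_sq_to_K]
  | succ n ih =>
    intro v hv
    obtain ⟨w, hw, u, hu, rfl⟩ := Submodule.mem_sup.1 hv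
    obtain ⟨h1, h2⟩ := ih w hw
    have hN := numberOp_of_mem_excitationLayer hab hbb hψ _ u hu
    have ho := excitationLayer_orthogonal hadj hab hbb hψ (Nat.lt_succ_self n)
    have hψn : ψ ∈ excitationSpace b ψ n :=
      excitationSpace_mono b ψ (Nat.zero_le n) (Submodule.mem_span_singleton_self ψ)
    constructor
    · rw [map_add, hN]
      exact add_mem (Submodule.mem_sup_left h1)
        (Submodule.mem_sup_right (Submodule.smul_mem _ _ hu))
    · have e1 : ‖ket (w + u)‖ ^ 2 = ‖ket w‖ ^ 2 + ‖ket u‖ ^ 2 := by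
        rw [map_add, @norm_add_sq ℂ, ho w hw u hu]; simp
      have e2 : ⟪ket u, ket (numberOp a b w)⟫_ℂ = 0 := by
        rw [← inner_conj_symm, ho _ h1 u hu, map_zero]
      have e3 : (⟪ket (w + u), ket (numberOp a b (w + u))⟫_ℂ).re =
          (⟪ket w, ket (numberOp a b w)⟫_ℂ).re + (n + 1) * ‖ket u‖ ^ 2 := by
        rw [map_add (numberOp a b), hN]
        simp only [map_add, map_smul, inner_add_left, inner_add_right, inner_smul_right, e2,
          ho w hw u hu, inner_self_eq_norm_sq_to_K]
        simp [← Complex.ofReal_pow, ← Complex.ofReal_natCast]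
      rw [e1, e3, map_add, inner_add_right, ho ψ hψn u hu, add_zero]
      nlinarith [sq_nonneg ‖ket u‖, Nat.cast_nonneg (α := ℝ) n]

/-- Spectral gap of the number operator of finitely many bosonic modes with cyclic vacuum. -/
theorem norm_sq_le_vacuum_add_number [Fintype ι] [DecidableEq ι]
    {a b : ι → D →ₗ[ℂ] D} {ψ : D} {ket : D →ₗ[ℂ] H}
    (hadj : ∀ k v w, ⟪ket (a k v), ket w⟫_ℂ = ⟪ket v, ket (b k w)⟫_ℂ)
    (hab : ∀ k l v, a k (b l v) = b l (a k v) + if k = l then v else 0)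
    (hbb : ∀ k l v, b k (b l v) = b l (b k v))
    (hψ : ∀ k, a k ψ = 0) (hnorm : ‖ket ψ‖ = 1)
    (hcyc : (⨆ n, (excitationSpace b ψ n).map ket).topologicalClosure = ⊤) (η : D) :
    ‖ket η‖ ^ 2 ≤ ‖⟪ket ψ, ket η⟫_ℂ‖ ^ 2 + (⟪ket η, ket (numberOp a b η)⟫_ℂ).re := by
  let K : ℕ → Submodule ℂ H := fun n => (excitationSpace b ψ n).map ket
  have hK : Monotone K := fun m n h => Submodule.map_mono (excitationSpace_mono b ψ h)
  have : ∀ n, FiniteDimensional ℂ (K n) := fun n => by dsimp only [K]; infer_instance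
  -- By cyclicity the projections onto the `K n` converge to `ket η`, so it suffices to bound the
  -- norm of each projection.
  have hlim := (Submodule.starProjection_tendsto_self K hK (ket η) hcyc.ge).norm.pow 2
  refine le_of_tendsto hlim (Eventually.of_forall fun n => ?_)
  obtain ⟨u, hu, hue⟩ := (K n).starProjection_apply_mem (ket η)
  have hr : ∀ v ∈ excitationSpace b ψ n, ⟪ket v, ket (η - u)⟫_ℂ = 0 := by
    intro v hv
    rw [map_sub, hue]
    exact (Submodule.mem_orthogonal _ _).1 ((K n).sub_starProjection_mem_orthogonal (ket η)) _
      (Submodule.mem_map_of_mem hv)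
  have hψn : ψ ∈ excitationSpace b ψ n :=
    excitationSpace_mono b ψ (Nat.zero_le n) (Submodule.mem_span_singleton_self ψ)
  obtain ⟨h1, h2⟩ := gap_on_excitationSpace hadj hab hbb hψ hnorm n u hu
  obtain ⟨r, hη⟩ : ∃ r, η = u + r := ⟨η - u, by abel⟩
  have hru : η - u = r := by rw [hη]; abel
  rw [hru] at hr
  have e1 : ⟪ket ψ, ket η⟫_ℂ = ⟪ket ψ, ket u⟫_ℂ := by
    rw [hη, map_add, inner_add_right, hr ψ hψn, add_zero]
  -- `N` preserves the excitation space and the remainder `r` is orthogonal to it, so both cross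
  -- terms vanish; `r` itself contributes a nonnegative amount.
  have e2 : ⟪ket u, ket (numberOp a b r)⟫_ℂ = 0 := by
    rw [← inner_numberOp_comm hadj, hr _ h1]
  have e3 : ⟪ket r, ket (numberOp a b u)⟫_ℂ = 0 := by
    rw [← inner_conj_symm, hr _ h1, map_zero]
  have e4 : 0 ≤ (⟪ket r, ket (numberOp a b r)⟫_ℂ).re := by
    rw [inner_numberOp hadj, Complex.re_sum]
    exact Finset.sum_nonneg fun k _ => inner_self_nonneg (𝕜 := ℂ)
  have e5 : (⟪ket η, ket (numberOp a b η)⟫_ℂ).re =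
      (⟪ket u, ket (numberOp a b u)⟫_ℂ).re + (⟪ket r, ket (numberOp a b r)⟫_ℂ).re := by
    rw [hη]
    simp only [map_add, inner_add_left, inner_add_right, e2, e3]
    simp
  rw [← hue, e1, e5]
  linarith

end Ladder

/-! ### Quadratures on Schwartz space: symmetry and commutation relations -/

variable {M : ℕ}

/-- `ket` as a continuous linear map. -/
noncomputable def ketCLM (M : ℕ) : TestSpace M →L[ℂ] ModeSpace M := SchwartzMap.toLpCLM ℂ ℂ 2 volume

theorem ketCLM_apply (η : TestSpace M) : ketCLM M η = ket η := rfl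

theorem denseRange_ket : DenseRange (ket : TestSpace M → ModeSpace M) :=
  SchwartzMap.denseRange_toLpCLM (F := ℂ) (E := Conf M) (p := 2) (μ := volume) (by simp)

theorem inner_ket_right (f : ModeSpace M) (η : TestSpace M) :
    ⟪f, ket η⟫_ℂ = ∫ x, starRingEnd ℂ (f x) * η x := by
  rw [L2.inner_def]
  refine integral_congr_ae ?_
  filter_upwards [η.coeFn_toLp 2 volume] with x hx
  rw [ket, hx, RCLike.inner_apply']

theorem inner_ket (η ζ : TestSpace M) :
    ⟪ket η, ket ζ⟫_ℂ = ∫ x, starRingEnd ℂ (η x) * ζ x := by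
  rw [inner_ket_right]
  refine integral_congr_ae ?_
  filter_upwards [η.coeFn_toLp 2 volume] with x hx
  rw [ket, hx]

theorem X_isHermitian (k : Fin M) : IsHermitianObservable (X k) := by
  intro η ζ
  rw [inner_ket, inner_ket]
  congr 1 with x
  rw [X_apply, X_apply, map_mul, Complex.conj_ofReal]
  ring

theorem P_isHermitian (k : Fin M) : IsHermitianObservable (P k) := by
  intro η ζ
  rw [inner_ket, inner_ket]
  -- Conjugation is only real linear, so integration by parts is applied to an `ℝ`-bilinear pairing.
  -- Its sign is cancelled by the conjugate of `-i`.
  let c : ℂ →L[ℝ] ℂ := (Complex.conjCLE : ℂ →L[ℝ] ℂ)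
  have h := SchwartzMap.integral_bilinear_lineDerivOp_right_eq_neg_left (μ := volume) η ζ
    ((ContinuousLinearMap.mul ℝ ℂ).comp c) (EuclideanSpace.single k (1 : ℝ))
  simp only [SchwartzMap.lineDerivOp_apply] at h
  simp only [P_apply, map_mul, map_neg, Complex.conj_I, neg_neg]
  have e1 : ∀ x, starRingEnd ℂ (η x) * (-Complex.I * lineDeriv ℝ ζ x (EuclideanSpace.single k 1)) =
      -Complex.I * ((((ContinuousLinearMap.mul ℝ ℂ).comp c) (η x))
        (lineDeriv ℝ ζ x (EuclideanSpace.single k 1))) := by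
    intro x
    simp [c]
    ring
  have e2 : ∀ x, Complex.I * starRingEnd ℂ (lineDeriv ℝ η x (EuclideanSpace.single k 1)) * ζ x =
      Complex.I * ((((ContinuousLinearMap.mul ℝ ℂ).comp c)
        (lineDeriv ℝ η x (EuclideanSpace.single k 1))) (ζ x)) := by
    intro x
    simp [c]
    ring
  simp only [e1, e2]
  rw [integral_const_mul, integral_const_mul, h]
  ring

theorem X_commute (k l : Fin M) : Commute (X k : Op M) (X l) := by
  ext η x
  simp only [mul_apply_eq_comp, X_apply]
  ring

theorem lineDeriv_lineDeriv_comm (η : TestSpace M) (v w x : Conf M) :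
    lineDeriv ℝ (fun y => lineDeriv ℝ η y w) x v = lineDeriv ℝ (fun y => lineDeriv ℝ η y v) x w := by
  have key : ∀ v w : Conf M, lineDeriv ℝ (fun y => lineDeriv ℝ η y w) x v =
      fderiv ℝ (fderiv ℝ η) x v w := by
    intro v w
    have h1 : (fun y => lineDeriv ℝ η y w) = fun y => fderiv ℝ η y w := by
      ext y
      exact (η.differentiable y).lineDeriv_eq_fderiv
    have h2 : DifferentiableAt ℝ (fderiv ℝ η) x :=
      ((η.smooth 2).fderiv_right (m := 1) (by norm_num)).differentiable (by norm_num) x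
    rw [h1, (h2.clm_apply (differentiableAt_const w)).lineDeriv_eq_fderiv,
      fderiv_clm_apply h2 (differentiableAt_const w)]
    simp
  rw [key, key]
  exact ((η.smooth 2).contDiffAt.isSymmSndFDerivAt (by simp)) v w

theorem P_commute (k l : Fin M) : Commute (P k : Op M) (P l) := by
  ext η x
  have h : ∀ k : Fin M, (P k η : Conf M → ℂ) =
      fun x => -Complex.I * lineDeriv ℝ η x (EuclideanSpace.single k (1 : ℝ)) := by
    intro k; ext x; exact P_apply k η x
  have h2 : ∀ (k l : Fin M), P k (P l η) x = -Complex.I * (-Complex.I *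
      lineDeriv ℝ (fun x => lineDeriv ℝ η x (EuclideanSpace.single l (1 : ℝ))) x
        (EuclideanSpace.single k (1 : ℝ))) := by
    intro k l
    rw [P_apply, h l]
    congr 1
    exact deriv_const_mul_field _
  rw [mul_apply_eq_comp, mul_apply_eq_comp, h2, h2,
    lineDeriv_lineDeriv_comm]

/-- The canonical commutation relation. -/
theorem X_mul_P (k l : Fin M) :
    (X k : Op M) * P l = P l * X k + (if k = l then Complex.I else 0) • (1 : Op M) := by
  ext η x
  have h : (X k η : Conf M → ℂ) = fun x => ((x k : ℝ) : ℂ) * η x := by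
    ext x; exact X_apply k η x
  have h1 : HasLineDerivAt ℝ (fun x : Conf M => ((x k : ℝ) : ℂ))
      ((if k = l then 1 else 0 : ℝ) : ℂ) x (EuclideanSpace.single l (1 : ℝ)) := by
    have := (Complex.ofRealCLM.comp (EuclideanSpace.proj k : Conf M →L[ℝ] ℝ)).hasFDerivAt (x := x)
    have := this.hasLineDerivAt (EuclideanSpace.single l (1 : ℝ))
    have e : (Complex.ofRealCLM.comp (EuclideanSpace.proj k : Conf M →L[ℝ] ℝ))
        (EuclideanSpace.single l (1 : ℝ)) = ((if k = l then 1 else 0 : ℝ) : ℂ) := by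
      simp [PiLp.single_apply]
    rwa [e] at this
  have h2 := (η.differentiable x).lineDifferentiableAt.hasLineDerivAt
    (v := EuclideanSpace.single l (1 : ℝ))
  have h3 : lineDeriv ℝ (X k η) x (EuclideanSpace.single l (1 : ℝ)) =
      ((if k = l then 1 else 0 : ℝ) : ℂ) * η x +
        (x k : ℂ) * lineDeriv ℝ η x (EuclideanSpace.single l (1 : ℝ)) := by
    rw [h]
    have := HasDerivAt.mul h1 h2
    simp only [zero_smul, add_zero] at this
    exact this.deriv
  simp only [mul_apply_eq_comp, add_apply, X_apply, P_apply,
    smul_apply, one_apply_eq_self, h3, smul_eq_mul]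
  split_ifs <;> simp <;> ring

/-! ### Ladder operators of the cubic phase state and factorisation of the witness -/

/-- The momentum conjugated by the cubic phase gate: `p̂_k - 3γ x̂_k²`. -/
noncomputable def shearedMomentum (γ : ℝ) (k : Fin M) : Op M := P k - (3 * γ : ℂ) • X k ^ 2

/-- The annihilation operator of the squeezed cubic phase state. -/
noncomputable def lowering (γ s : ℝ) (k : Fin M) : Op M :=
  ((√2)⁻¹ : ℂ) • ((s : ℂ)⁻¹ • X k + (Complex.I * s) • shearedMomentum γ k)

/-- The creation operator of the squeezed cubic phase state. -/
noncomputable def raising (γ s : ℝ) (k : Fin M) : Op M :=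
  ((√2)⁻¹ : ℂ) • ((s : ℂ)⁻¹ • X k - (Complex.I * s) • shearedMomentum γ k)

theorem ofReal_sqrt_two_sq : ((√2 : ℝ) : ℂ) ^ 2 = 2 := by
  rw [← Complex.ofReal_pow, Real.sq_sqrt (by norm_num)]
  norm_num

theorem X_mul_shearedMomentum (γ : ℝ) (k l : Fin M) :
    (X k : Op M) * shearedMomentum γ l =
      shearedMomentum γ l * X k + (if k = l then Complex.I else 0) • (1 : Op M) := by
  rw [shearedMomentum, mul_sub, sub_mul, X_mul_P, mul_smul_comm, smul_mul_assoc,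
    ((X_commute k l).pow_right 2).eq]
  abel

theorem shearedMomentum_commute (γ : ℝ) (k l : Fin M) :
    Commute (shearedMomentum γ k : Op M) (shearedMomentum γ l) := by
  rcases eq_or_ne k l with rfl | hkl
  · exact Commute.refl _
  have h : ∀ {k l : Fin M}, k ≠ l → Commute (X k : Op M) (P l) := by
    intro k l hkl
    have := X_mul_P k l
    rwa [if_neg hkl, zero_smul, add_zero] at this
  unfold shearedMomentum
  exact ((P_commute k l).sub_right (((h hkl.symm).symm.pow_right 2).smul_right _)).sub_left
    ((((h hkl).pow_left 2).sub_right
      (((X_commute k l).pow_pow 2 2).smul_right _)).smul_left _)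

theorem raising_commute (γ s : ℝ) (k l : Fin M) :
    Commute (raising γ s k : Op M) (raising γ s l) := by
  rcases eq_or_ne k l with rfl | hkl
  · exact Commute.refl _
  have h : ∀ {k l : Fin M}, k ≠ l → Commute (X k : Op M) (shearedMomentum γ l) := by
    intro k l hkl
    have := X_mul_shearedMomentum γ k l
    rwa [if_neg hkl, zero_smul, add_zero] at this
  unfold raising
  refine Commute.smul_left (Commute.smul_right (Commute.sub_left (Commute.sub_right ?_ ?_)
    (Commute.sub_right ?_ ?_)) _) _
  · exact ((X_commute k l).smul_right _).smul_left _
  · exact ((h hkl).smul_right _).smul_left _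
  · exact ((h hkl.symm).symm.smul_right _).smul_left _
  · exact ((shearedMomentum_commute γ k l).smul_right _).smul_left _

theorem lowering_mul_raising (γ : ℝ) {s : ℝ} (hs : s ≠ 0) (k l : Fin M) :
    lowering γ s k * raising γ s l =
      raising γ s l * lowering γ s k + (if k = l then 1 else 0 : ℂ) • (1 : Op M) := by
  have hs' : (s : ℂ) ≠ 0 := by exact_mod_cast hs
  have h2 := ofReal_sqrt_two_sq
  have hX := (X_commute k l).eq
  have hQ := (shearedMomentum_commute γ k l).eq
  have h1 := X_mul_shearedMomentum γ k l
  have h3 := X_mul_shearedMomentum γ l k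
  have hc : (if l = k then Complex.I else 0) = if k = l then Complex.I else 0 := by
    simp only [eq_comm]
  rw [hc] at h3
  have hI : (if k = l then 1 else 0 : ℂ) = -Complex.I * (if k = l then Complex.I else 0) := by
    split_ifs <;> simp
  rw [hI]
  -- With the Kronecker symbol as a free scalar, one normalisation covers both `k = l` and `k ≠ l`.
  generalize (if k = l then Complex.I else 0 : ℂ) = d at *
  unfold lowering raising
  simp only [smul_mul_assoc, mul_smul_comm, add_mul, mul_add, sub_mul, mul_sub, smul_smul, smul_add,
    smul_sub, h1, h3, hX, hQ, ← mul_assoc]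
  match_scalars <;> (field_simp; try simp only [h2]); ring

/-- The square of `p - 3γx²` has cross term `-3γ(px² + x²p)`. It becomes a combination of cubes
because `(x-p)³ - (x+p)³ = -2p³ - 3(px² + x²p)`, using `2xpx = px² + x²p`; the term `2γp³` in `w`
cancels the leftover. The `1/2` is the commutator `[x, p] = i`. -/
theorem raising_mul_lowering (γ : ℝ) {s : ℝ} (hs : s ≠ 0) (k : Fin M) :
    raising γ s k * lowering γ s k = w γ s k - (1 / 2 : ℂ) • (1 : Op M) := by
  have hs' : (s : ℂ) ≠ 0 := by exact_mod_cast hs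
  have h2 := ofReal_sqrt_two_sq
  have hXP : (X k : Op M) * P k = P k * X k + Complex.I • (1 : Op M) := by
    simpa using X_mul_P k k
  -- Normal ordering, with every `P` to the left, inside right-nested products as well.
  have hXP' : ∀ T : Op M, (X k : Op M) * (P k * T) = P k * (X k * T) + Complex.I • T := by
    intro T
    rw [← mul_assoc, hXP, add_mul, smul_mul_assoc, one_mul, mul_assoc]
  unfold lowering raising w shearedMomentum
  simp only [pow_succ, pow_zero, one_mul, smul_mul_assoc, mul_smul_comm, add_mul, mul_add, sub_mul,
    mul_sub, smul_smul, smul_add, smul_sub, mul_assoc, hXP, hXP', mul_one]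
  push_cast
  match_scalars <;> field_simp <;> (try simp only [h2, Complex.I_sq]) <;> ring

theorem witness_eq (γ : ℝ) {s : ℝ} (hs : s ≠ 0) (M : ℕ) :
    witness γ s M = 1 - ∑ k, raising γ s k * lowering γ s k := by
  simp only [witness, raising_mul_lowering γ hs, Finset.sum_sub_distrib, Finset.sum_const,
    Finset.card_univ, Fintype.card_fin]
  rw [← Nat.cast_smul_eq_nsmul ℂ]
  module

/-- `B` is a formal adjoint of `A` on Schwartz space. -/
def IsFormalAdjoint (A B : Op M) : Prop :=
  ∀ η ζ : TestSpace M, ⟪ket (A η), ket ζ⟫_ℂ = ⟪ket η, ket (B ζ)⟫_ℂ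

namespace IsFormalAdjoint

variable {A B A' B' : Op M}

theorem one : IsFormalAdjoint (1 : Op M) 1 := fun _ _ => rfl

theorem symm (h : IsFormalAdjoint A B) : IsFormalAdjoint B A := fun η ζ => by
  rw [← inner_conj_symm, ← h, inner_conj_symm]

theorem add (h : IsFormalAdjoint A B) (h' : IsFormalAdjoint A' B') :
    IsFormalAdjoint (A + A') (B + B') := fun η ζ => by
  simp only [add_apply, ← ketCLM_apply, map_add, inner_add_left, inner_add_right]
  exact congrArg₂ _ (h η ζ) (h' η ζ)

theorem smul (c : ℂ) (h : IsFormalAdjoint A B) :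
    IsFormalAdjoint (c • A) (starRingEnd ℂ c • B) := fun η ζ => by
  simp only [smul_apply, ← ketCLM_apply, map_smul, inner_smul_left, inner_smul_right]
  exact congrArg _ (h η ζ)

theorem sub (h : IsFormalAdjoint A B) (h' : IsFormalAdjoint A' B') :
    IsFormalAdjoint (A - A') (B - B') := by
  have := h.add (h'.smul (-1))
  simpa [sub_eq_add_neg] using this

theorem mul (h : IsFormalAdjoint A B) (h' : IsFormalAdjoint A' B') :
    IsFormalAdjoint (A * A') (B' * B) := fun η ζ => (h (A' η) ζ).trans (h' η (B ζ))

theorem sum {ι : Type*} (t : Finset ι) {A B : ι → Op M} (h : ∀ i, IsFormalAdjoint (A i) (B i)) :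
    IsFormalAdjoint (∑ i ∈ t, A i) (∑ i ∈ t, B i) := fun η ζ => by
  simp only [sum_apply, ← ketCLM_apply, map_sum, sum_inner, inner_sum]
  exact Finset.sum_congr rfl fun i _ => h i η ζ

end IsFormalAdjoint

theorem isFormalAdjoint_lowering (γ s : ℝ) (k : Fin M) :
    IsFormalAdjoint (lowering γ s k) (raising γ s k) := by
  have hX : IsFormalAdjoint (X k : Op M) (X k) := X_isHermitian k
  have hP : IsFormalAdjoint (P k : Op M) (P k) := P_isHermitian k
  have hQ := hP.sub ((hX.mul hX).smul (3 * γ : ℂ))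
  have h3 : starRingEnd ℂ (3 * γ : ℂ) = 3 * γ := by
    have := Complex.conj_ofReal (3 * γ)
    push_cast at this
    exact this
  rw [h3] at hQ
  have h := ((hX.smul (s : ℂ)⁻¹).add (hQ.smul (Complex.I * s))).smul ((√2 : ℝ) : ℂ)⁻¹
  simp only [map_inv₀, map_mul, Complex.conj_ofReal, Complex.conj_I, neg_mul, neg_smul,
    ← sub_eq_add_neg, ← pow_two] at h
  exact h

theorem witness_isHermitian (γ : ℝ) {s : ℝ} (hs : s ≠ 0) (M : ℕ) :
    IsHermitianObservable (witness γ s M) := by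
  rw [witness_eq γ hs]
  exact IsFormalAdjoint.one.sub (IsFormalAdjoint.sum _ fun k =>
    (isFormalAdjoint_lowering γ s k).symm.mul (isFormalAdjoint_lowering γ s k))

/-! ### Decomposition into homodyne observables -/

theorem quadrature_pi_div_four_pow_three (k : Fin M) :
    (X k + P k : Op M) ^ 3 = ((2 * √2 : ℝ) : ℂ) • quadrature k (Real.pi / 4) ^ 3 := by
  have h : (X k + P k : Op M) = ((√2 : ℝ) : ℂ) • quadrature k (Real.pi / 4) := by
    have e : ((√2 : ℝ) : ℂ) * ((√2 / 2 : ℝ) : ℂ) = 1 := by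
      push_cast
      linear_combination ofReal_sqrt_two_sq / 2
    rw [quadrature, Real.cos_pi_div_four, Real.sin_pi_div_four, ← smul_add, smul_smul, e, one_smul]
  rw [h, smul_pow]
  congr 1
  push_cast
  linear_combination ((√2 : ℝ) : ℂ) * ofReal_sqrt_two_sq

theorem quadrature_neg_pi_div_four_pow_three (k : Fin M) :
    (X k - P k : Op M) ^ 3 = ((2 * √2 : ℝ) : ℂ) • quadrature k (-(Real.pi / 4)) ^ 3 := by
  have h : (X k - P k : Op M) = ((√2 : ℝ) : ℂ) • quadrature k (-(Real.pi / 4)) := by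
    have e : ((√2 : ℝ) : ℂ) * ((√2 / 2 : ℝ) : ℂ) = 1 := by
      push_cast
      linear_combination ofReal_sqrt_two_sq / 2
    rw [quadrature, Real.cos_neg, Real.sin_neg, Real.cos_pi_div_four, Real.sin_pi_div_four,
      Complex.ofReal_neg, neg_smul, ← sub_eq_add_neg, ← smul_sub, smul_smul, e, one_smul]
  rw [h, smul_pow]
  congr 1
  push_cast
  linear_combination ((√2 : ℝ) : ℂ) * ofReal_sqrt_two_sq

theorem witness_homodyneMeasurable (γ s : ℝ) (M : ℕ) :
    HomodyneMeasurable (6 * M) 4 4 (witness γ s M) := by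
  let e : Fin (6 * M) ≃ Fin 6 × Fin M := finProdFinEquiv.symm
  -- Per mode: `x²`, `x⁴`, `p²`, `p³`, `(x-p)³`, `(x+p)³`. Phases `0` and `π/2` serve twice, hence
  -- six powers but four phases; the factor `2√2` comes from `x ± p = √2 q(±π/4)`.
  let phases : Fin 6 → ℝ := ![0, 0, Real.pi / 2, Real.pi / 2, -(Real.pi / 4), Real.pi / 4]
  let degs : Fin 6 → ℕ := ![2, 4, 2, 3, 3, 3]
  let coeffs : Fin 6 → ℝ := ![-(1 / (2 * s ^ 2)), -(s ^ 2 / 2 * (9 * γ ^ 2)), -(s ^ 2 / 2),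
    -(s ^ 2 / 2 * (2 * γ)), -(s ^ 2 / 2 * γ * (2 * √2)), s ^ 2 / 2 * γ * (2 * √2)]
  refine ⟨6 * M, 1 + M / 2, fun i => coeffs (e i).1, fun i => (e i).2, fun i => phases (e i).1,
    fun i => degs (e i).1, le_rfl, fun i => ?_, fun k => ?_, ?_⟩
  · have h : ∀ j, degs j ≤ 4 := by decide
    exact h _
  · let t : Finset ℝ := {0, Real.pi / 2, -(Real.pi / 4), Real.pi / 4}
    calc _ ≤ (t : Set ℝ).ncard := by
          refine Set.ncard_le_ncard ?_ t.finite_toSet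
          rintro θ ⟨i, -, rfl⟩
          dsimp only
          generalize (e i).1 = j
          fin_cases j <;> simp [phases, t]
      _ ≤ 4 := by rw [Set.ncard_coe_finset]; exact Finset.card_le_four
  · have h0 : ∀ k : Fin M, quadrature k 0 = X k := fun k => by simp [quadrature]
    have h1 : ∀ k : Fin M, quadrature k (Real.pi / 2) = P k := fun k => by simp [quadrature]
    have hsum := e.symm.sum_comp fun i : Fin (6 * M) => (coeffs (e i).1 : ℂ) •
      quadrature (e i).2 (phases (e i).1) ^ degs (e i).1
    rw [← hsum, Fintype.sum_prod_type_right, witness, sub_eq_add_neg, ← Finset.sum_neg_distrib]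
    congr 1
    · push_cast; rfl
    · refine Finset.sum_congr rfl fun k _ => ?_
      simp only [Equiv.apply_symm_apply, Fin.sum_univ_six]
      simp only [coeffs, phases, degs, Matrix.cons_val, h0, h1, w,
        quadrature_pi_div_four_pow_three, quadrature_neg_pi_div_four_pow_three]
      push_cast
      module

/-! ### The target wave function is a normalised Schwartz function -/

section Decay

variable {E : Type*} [NormedAddCommGroup E] [NormedSpace ℝ E]

/-- A rapidly decaying function whose logarithmic derivative has temperate growth is rapidly
decaying together with all its derivatives. -/
theorem decay_of_fderiv_eq_smul {f : E → ℂ} {g : E → E →L[ℝ] ℂ} (hf : ContDiff ℝ ∞ f)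
    (hg : g.HasTemperateGrowth) (hfg : ∀ x, fderiv ℝ f x = f x • g x)
    (h0 : ∀ k : ℕ, ∃ C, ∀ x, ‖x‖ ^ k * ‖f x‖ ≤ C) (n : ℕ) :
    ∀ k : ℕ, ∃ C, ∀ x, ‖x‖ ^ k * ‖iteratedFDeriv ℝ n f x‖ ≤ C := by
  induction n using Nat.strong_induction_on with
  | _ n ih =>
    rcases n with _ | n
    · simpa using h0
    intro k
    obtain ⟨m, C, hC0, hC⟩ := hg.norm_iteratedFDeriv_le_uniform n
    have hterm : ∀ i ∈ Finset.range (n + 1), ∃ D, ∀ x, ‖x‖ ^ k * ((n.choose i : ℝ) *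
        ‖iteratedFDeriv ℝ i f x‖ * ‖iteratedFDeriv ℝ (n - i) g x‖) ≤ D := by
      intro i hi
      -- Two weights are needed because the growth factor `(1 + ‖x‖)^m` of `g` is bounded by `2^m (1
      -- + ‖x‖^m)`.
      obtain ⟨D₁, h₁⟩ := ih i (Finset.mem_range.1 hi) k
      obtain ⟨D₂, h₂⟩ := ih i (Finset.mem_range.1 hi) (k + m)
      refine ⟨n.choose i * C * 2 ^ m * (D₁ + D₂), fun x => ?_⟩
      have h₃ := hC (n - i) (Nat.sub_le _ _) x
      have h₄ : (1 + ‖x‖) ^ m ≤ 2 ^ m * (1 + ‖x‖ ^ m) := by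
        have h := add_pow_le (zero_le_one (α := ℝ)) (norm_nonneg x) m
        refine h.trans ?_
        rw [one_pow]
        gcongr
        · norm_num
        · exact Nat.sub_le _ _
      calc ‖x‖ ^ k * ((n.choose i : ℝ) * ‖iteratedFDeriv ℝ i f x‖ *
            ‖iteratedFDeriv ℝ (n - i) g x‖)
          ≤ ‖x‖ ^ k * ((n.choose i : ℝ) * ‖iteratedFDeriv ℝ i f x‖ *
            (C * (2 ^ m * (1 + ‖x‖ ^ m)))) := by
            gcongr
            exact h₃.trans (by gcongr)
        _ = n.choose i * C * 2 ^ m * (‖x‖ ^ k * ‖iteratedFDeriv ℝ i f x‖ +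
            ‖x‖ ^ (k + m) * ‖iteratedFDeriv ℝ i f x‖) := by ring
        _ ≤ _ := by
            gcongr
            · exact h₁ x
            · exact h₂ x
    choose! D hD using hterm
    refine ⟨∑ i ∈ Finset.range (n + 1), D i, fun x => ?_⟩
    -- The derivative of order `n + 1` of `f` is the one of order `n` of `f • g`; Leibniz then
    -- involves only lower derivatives of `f`.
    rw [← norm_iteratedFDeriv_fderiv, show fderiv ℝ f = fun x => f x • g x from funext hfg]
    calc _ ≤ ‖x‖ ^ k * ∑ i ∈ Finset.range (n + 1), (n.choose i : ℝ) *
          ‖iteratedFDeriv ℝ i f x‖ * ‖iteratedFDeriv ℝ (n - i) g x‖ := by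
          gcongr
          exact norm_iteratedFDeriv_smul_le hf hg.1 x (by exact_mod_cast le_top)
      _ ≤ _ := by
          rw [Finset.mul_sum]
          exact Finset.sum_le_sum fun i hi => hD i hi x

theorem pow_mul_exp_neg_mul_sq_le {a : ℝ} (ha : 0 < a) (k : ℕ) {t : ℝ} (ht : 0 ≤ t) :
    t ^ k * Real.exp (-a * t ^ 2) ≤ 1 + k.factorial / a ^ k := by
  have h1 := Real.pow_div_factorial_le_exp (x := a * t ^ 2) (by positivity) k
  have h2 : t ^ k ≤ 1 + (t ^ 2) ^ k := by
    rw [← pow_mul, mul_comm, pow_mul]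
    have h := pow_nonneg ht k
    nlinarith [sq_nonneg (t ^ k - 1)]
  have h3 : Real.exp (-a * t ^ 2) = (Real.exp (a * t ^ 2))⁻¹ := by
    rw [← Real.exp_neg]; ring_nf
  have h4 : (1 : ℝ) ≤ Real.exp (a * t ^ 2) := Real.one_le_exp (by positivity)
  rw [h3, ← div_eq_mul_inv, div_le_iff₀ (Real.exp_pos _)]
  have h5 : (t ^ 2) ^ k ≤ k.factorial / a ^ k * Real.exp (a * t ^ 2) := by
    rw [mul_pow, div_le_iff₀ (by positivity)] at h1
    rw [div_mul_eq_mul_div, le_div_iff₀ (by positivity)]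
    linarith
  linarith

end Decay

/-- The logarithm of the target wave function, up to normalisation. -/
noncomputable def targetPhase (γ s : ℝ) (M : ℕ) (x : Conf M) : ℂ :=
  ∑ k, (Complex.I * γ * (x k : ℂ) ^ 3 - (x k : ℂ) ^ 2 / (2 * s ^ 2))

/-- The coordinate `x ↦ x_k`, complex valued. -/
noncomputable def coordCLM (k : Fin M) : Conf M →L[ℝ] ℂ :=
  Complex.ofRealCLM.comp (EuclideanSpace.proj k : Conf M →L[ℝ] ℝ)

theorem coordCLM_apply (k : Fin M) (x : Conf M) : coordCLM k x = (x k : ℂ) := rfl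

/-- The differential of `targetPhase`. -/
noncomputable def targetPhaseDeriv (γ s : ℝ) (M : ℕ) (x : Conf M) : Conf M →L[ℝ] ℂ :=
  ∑ k, (3 * Complex.I * γ * (x k : ℂ) ^ 2 - (x k : ℂ) / s ^ 2) • coordCLM k

theorem cubicPhaseWave_eq (γ s t : ℝ) : cubicPhaseWave γ s t =
    ((√s * Real.pi ^ (1 / 4 : ℝ) : ℝ) : ℂ)⁻¹ *
      Complex.exp (Complex.I * γ * t ^ 3 - t ^ 2 / (2 * s ^ 2)) := by
  rw [cubicPhaseWave, ← Complex.exp_add, div_eq_inv_mul, neg_div, ← sub_eq_add_neg]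

theorem targetWave_eq (γ s : ℝ) (M : ℕ) : targetWave γ s M = fun x =>
    (((√s * Real.pi ^ (1 / 4 : ℝ) : ℝ) : ℂ)⁻¹) ^ M * Complex.exp (targetPhase γ s M x) := by
  ext x
  simp only [targetWave, cubicPhaseWave_eq, Finset.prod_mul_distrib, Finset.prod_const,
    Finset.card_univ, Fintype.card_fin, targetPhase, Complex.exp_sum]

theorem norm_targetWave (γ : ℝ) {s : ℝ} (hs : 0 < s) (M : ℕ) (x : Conf M) :
    ‖targetWave γ s M x‖ =
      ((√s * Real.pi ^ (1 / 4 : ℝ))⁻¹) ^ M * Real.exp (-(2 * s ^ 2)⁻¹ * ‖x‖ ^ 2) := by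
  have hA : 0 ≤ √s * Real.pi ^ (1 / 4 : ℝ) := by positivity
  have hre : (targetPhase γ s M x).re = -(2 * s ^ 2)⁻¹ * ‖x‖ ^ 2 := by
    rw [EuclideanSpace.norm_sq_eq, Finset.mul_sum, targetPhase, Complex.re_sum]
    refine Finset.sum_congr rfl fun k _ => ?_
    have : Complex.I * γ * (x k : ℂ) ^ 3 - (x k : ℂ) ^ 2 / (2 * s ^ 2) =
        ((-(x k ^ 2 / (2 * s ^ 2)) : ℝ) : ℂ) + ((γ * x k ^ 3 : ℝ) : ℂ) * Complex.I := by
      push_cast; ring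
    rw [this, Complex.add_re, Complex.ofReal_re, Complex.re_ofReal_mul, Complex.I_re,
      Real.norm_eq_abs, sq_abs]
    ring
  rw [targetWave_eq, norm_mul, norm_pow, norm_inv, Complex.norm_real, Real.norm_of_nonneg hA,
    Complex.norm_exp, hre]

theorem hasFDerivAt_targetPhase (γ s : ℝ) (M : ℕ) (x : Conf M) :
    HasFDerivAt (targetPhase γ s M) (targetPhaseDeriv γ s M x) x := by
  unfold targetPhase targetPhaseDeriv
  refine HasFDerivAt.fun_sum fun k _ => ?_
  have h1 : HasFDerivAt (fun x : Conf M => (x k : ℂ)) (coordCLM k) x := (coordCLM k).hasFDerivAt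
  have h2 : HasDerivAt (fun z : ℂ => Complex.I * γ * z ^ 3 - z ^ 2 / (2 * s ^ 2))
      (3 * Complex.I * γ * (x k : ℂ) ^ 2 - (x k : ℂ) / s ^ 2) (x k : ℂ) := by
    have h := ((hasDerivAt_pow 3 (x k : ℂ)).const_mul (Complex.I * γ)).sub
      ((hasDerivAt_pow 2 (x k : ℂ)).div_const (2 * (s : ℂ) ^ 2))
    refine h.congr_deriv ?_
    have e : (2 : ℂ) * (x k : ℂ) / (2 * s ^ 2) = (x k : ℂ) / s ^ 2 :=
      mul_div_mul_left _ _ two_ne_zero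
    simp only [Nat.cast_ofNat, Nat.add_one_sub_one, pow_one, e]
    ring
  exact h2.comp_hasFDerivAt x h1

theorem fderiv_targetWave (γ s : ℝ) (M : ℕ) (x : Conf M) :
    fderiv ℝ (targetWave γ s M) x = targetWave γ s M x • targetPhaseDeriv γ s M x := by
  rw [targetWave_eq]
  have h := (hasFDerivAt_targetPhase γ s M x).cexp.const_mul
    ((((√s * Real.pi ^ (1 / 4 : ℝ) : ℝ) : ℂ)⁻¹) ^ M)
  rw [h.fderiv, smul_smul]

theorem hasTemperateGrowth_targetPhaseDeriv (γ s : ℝ) (M : ℕ) :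
    (targetPhaseDeriv γ s M).HasTemperateGrowth := by
  unfold targetPhaseDeriv
  refine Function.HasTemperateGrowth.sum fun k _ => ?_
  have h : (fun x : Conf M => (x k : ℂ)).HasTemperateGrowth := (coordCLM k).hasTemperateGrowth
  refine Function.HasTemperateGrowth.smul (𝕜 := ℂ) ?_
    (Function.HasTemperateGrowth.const (E := Conf M) (coordCLM k))
  exact ((Function.HasTemperateGrowth.const (3 * Complex.I * γ)).mul (h.pow 2)).sub
    (by
      simp only [div_eq_mul_inv]
      exact h.mul (Function.HasTemperateGrowth.const ((s : ℂ) ^ 2)⁻¹))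

/-- The target wave function as a Schwartz function. -/
noncomputable def targetSchwartz (γ : ℝ) {s : ℝ} (hs : 0 < s) (M : ℕ) : TestSpace M where
  toFun := targetWave γ s M
  smooth' := by
    unfold targetWave cubicPhaseWave
    have h : ∀ k : Fin M, ContDiff ℝ ∞ fun x : Conf M => (x k : ℂ) :=
      fun k => (coordCLM k).contDiff
    fun_prop
  decay' k n := by
    refine decay_of_fderiv_eq_smul ?_ (hasTemperateGrowth_targetPhaseDeriv γ s M)
      (fderiv_targetWave γ s M) (fun k => ?_) n k
    · unfold targetWave cubicPhaseWave
      have h : ∀ k : Fin M, ContDiff ℝ ∞ fun x : Conf M => (x k : ℂ) :=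
        fun k => (coordCLM k).contDiff
      fun_prop
    · refine ⟨((√s * Real.pi ^ (1 / 4 : ℝ))⁻¹) ^ M *
        (1 + k.factorial / ((2 * s ^ 2)⁻¹) ^ k), fun x => ?_⟩
      rw [norm_targetWave γ hs, mul_left_comm]
      gcongr
      exact pow_mul_exp_neg_mul_sq_le (by positivity) k (norm_nonneg x)

theorem targetSchwartz_apply (γ : ℝ) {s : ℝ} (hs : 0 < s) (x : Conf M) :
    targetSchwartz γ hs M x = targetWave γ s M x := rfl

theorem ket_targetSchwartz (γ : ℝ) {s : ℝ} (hs : 0 < s) (M : ℕ) :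
    ket (targetSchwartz γ hs M) = targetVec γ hs M := rfl

theorem integral_norm_sq_cubicPhaseWave (γ : ℝ) {s : ℝ} (hs : 0 < s) :
    ∫ t : ℝ, ‖cubicPhaseWave γ s t‖ ^ 2 = 1 := by
  have hA : 0 ≤ √s * Real.pi ^ (1 / 4 : ℝ) := by positivity
  have h : ∀ t : ℝ, ‖cubicPhaseWave γ s t‖ ^ 2 =
      ((√s * Real.pi ^ (1 / 4 : ℝ)) ^ 2)⁻¹ * Real.exp (-(s ^ 2)⁻¹ * t ^ 2) := by
    intro t
    have e : Complex.I * γ * t ^ 3 - (t : ℂ) ^ 2 / (2 * s ^ 2) =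
        ((-(t ^ 2 / (2 * s ^ 2)) : ℝ) : ℂ) + ((γ * t ^ 3 : ℝ) : ℂ) * Complex.I := by
      push_cast; ring
    rw [cubicPhaseWave_eq, norm_mul, norm_inv, Complex.norm_real, Real.norm_of_nonneg hA,
      Complex.norm_exp, e, Complex.add_re, Complex.ofReal_re, Complex.re_ofReal_mul, Complex.I_re,
      mul_pow, inv_pow, ← Real.exp_nat_mul]
    congr 2
    field_simp
    push_cast
    ring
  have hpi : (Real.pi ^ (1 / 4 : ℝ)) ^ 2 = √Real.pi := by
    rw [Real.sqrt_eq_rpow, ← Real.rpow_natCast, ← Real.rpow_mul Real.pi_pos.le]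
    norm_num
  simp_rw [h]
  rw [integral_const_mul, integral_gaussian, mul_pow, Real.sq_sqrt hs.le, hpi, div_inv_eq_mul,
    Real.sqrt_mul Real.pi_pos.le, Real.sqrt_sq hs.le]
  have := Real.sqrt_pos.2 Real.pi_pos
  field_simp

theorem norm_targetVec (γ : ℝ) {s : ℝ} (hs : 0 < s) (M : ℕ) : ‖targetVec γ hs M‖ = 1 := by
  have h1 : ⟪targetVec γ hs M, targetVec γ hs M⟫_ℂ =
      ((∫ x : Conf M, ‖targetWave γ s M x‖ ^ 2 : ℝ) : ℂ) := by
    rw [← ket_targetSchwartz, inner_ket, ← integral_complex_ofReal]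
    congr 1 with x
    rw [targetSchwartz_apply, Complex.conj_mul']
    push_cast
    rfl
  have h2 : ∫ x : Conf M, ‖targetWave γ s M x‖ ^ 2 = 1 := by
    have h3 := (EuclideanSpace.volume_preserving_symm_measurableEquiv_toLp (Fin M)).integral_comp'
      (fun y : Fin M → ℝ => ∏ k, ‖cubicPhaseWave γ s (y k)‖ ^ 2)
    have h4 : ∀ x : Conf M, ‖targetWave γ s M x‖ ^ 2 =
        ∏ k, ‖cubicPhaseWave γ s ((MeasurableEquiv.toLp 2 (Fin M → ℝ)).symm x k)‖ ^ 2 := by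
      intro x
      rw [targetWave, norm_prod, Finset.prod_pow]
      rfl
    simp_rw [h4]
    rw [h3, volume_pi, integral_fintype_prod_eq_prod (fun (_ : Fin M) (t : ℝ) =>
      ‖cubicPhaseWave γ s t‖ ^ 2)]
    simp [integral_norm_sq_cubicPhaseWave γ hs]
  rw [h2, inner_self_eq_norm_sq_to_K] at h1
  have h5 : ‖targetVec γ hs M‖ ^ 2 = 1 := Complex.ofReal_injective (by simpa using h1)
  exact (pow_eq_one_iff_of_nonneg (norm_nonneg _) two_ne_zero).1 h5

/-- The logarithmic derivative of `ψ` is `3iγx² - x/s²`, so `(p - 3γx²)ψ = (i/s²) xψ` and the two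
terms of `a_k ψ` cancel. -/
theorem lowering_targetSchwartz (γ : ℝ) {s : ℝ} (hs : 0 < s) (k : Fin M) :
    lowering γ s k (targetSchwartz γ hs M) = 0 := by
  have hs' : (s : ℂ) ≠ 0 := by exact_mod_cast hs.ne'
  ext x
  have h : P k (targetSchwartz γ hs M) x = -Complex.I * (targetWave γ s M x *
      (3 * Complex.I * γ * (x k : ℂ) ^ 2 - (x k : ℂ) / s ^ 2)) := by
    rw [P_apply, (SchwartzMap.differentiable _ x).lineDeriv_eq_fderiv,
      show (⇑(targetSchwartz γ hs M) : Conf M → ℂ) = targetWave γ s M from rfl, fderiv_targetWave]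
    simp [targetPhaseDeriv, coordCLM_apply, sum_apply, PiLp.single_apply, apply_ite]
  simp only [lowering, shearedMomentum, smul_apply, add_apply, sub_apply, pow_two,
    mul_apply_eq_comp, X_apply, h, targetSchwartz_apply, smul_eq_mul, zero_apply]
  field_simp
  ring_nf
  have hI : Complex.I ^ 3 = -Complex.I := by rw [pow_succ, Complex.I_sq, neg_one_mul]
  simp only [hI, Complex.I_sq]
  ring

/-! ### Totality of the excitations of the target state -/

/-- An integrable function with vanishing characteristic integrals vanishes almost everywhere. -/
theorem ae_eq_zero_of_forall_integral_cexp_inner_eq_zero {V : Type*} [NormedAddCommGroup V]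
    [InnerProductSpace ℝ V] [FiniteDimensional ℝ V] [MeasurableSpace V] [BorelSpace V]
    {h : V → ℂ} (hh : Integrable h)
    (h0 : ∀ t : V, ∫ x, Complex.exp (Complex.I * (inner ℝ t x : ℝ)) * h x = 0) :
    ∀ᵐ x, h x = 0 := by
  have hF : 𝓕 h = 0 := by
    ext w
    -- The kernel is `e^{-2πi⟨v, w⟩}`, hence the frequency `-2πw`.
    rw [Real.fourier_eq', Pi.zero_apply, ← h0 ((-2 * Real.pi) • w)]
    congr 1 with v
    rw [smul_eq_mul, real_inner_smul_left, real_inner_comm]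
    congr 2
    push_cast
    ring
  refine ae_eq_zero_of_integral_contDiff_smul_eq_zero hh.locallyIntegrable fun g hg hgc => ?_
  have hg₁ : HasCompactSupport (Complex.ofRealCLM ∘ g) := hgc.comp_left rfl
  have hg₂ : ContDiff ℝ ∞ (Complex.ofRealCLM ∘ g) := by fun_prop
  -- Writing the test function as the Fourier transform of `Φ` moves the transform onto `h`, where
  -- it vanishes.
  let G : 𝓢(V, ℂ) := hg₁.toSchwartzMap hg₂
  let Φ : 𝓢(V, ℂ) := 𝓕⁻ G
  have hG : 𝓕 (⇑Φ) = ⇑G := by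
    rw [← SchwartzMap.fourier_coe, FourierTransform.fourier_fourierInv_eq]
  have key : ∫ ξ, 𝓕 (⇑Φ) ξ • h ξ = ∫ x, Φ x • 𝓕 h x := by
    simpa using! VectorFourier.integral_fourierIntegral_smul_eq_flip (L := innerₗ V)
      Real.continuous_fourierChar continuous_inner Φ.integrable hh
  rw [hG, hF] at key
  simpa [G] using key

theorem integrable_exp_neg_mul_norm_sq {V : Type*} [NormedAddCommGroup V]
    [InnerProductSpace ℝ V] [FiniteDimensional ℝ V] [MeasurableSpace V] [BorelSpace V]
    {b : ℝ} (hb : 0 < b) : Integrable fun v : V => Real.exp (-b * ‖v‖ ^ 2) := by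
  have h := (GaussianFourier.integrable_cexp_neg_mul_sq_norm_add (V := V) (b := (b : ℂ))
    (by simpa using hb) 0 0).norm
  refine h.congr (Eventually.of_forall fun v => ?_)
  dsimp only
  rw [show -(b : ℂ) * (‖v‖ : ℂ) ^ 2 + 0 * ((inner ℝ (0 : V) v : ℝ) : ℂ) =
    ((-b * ‖v‖ ^ 2 : ℝ) : ℂ) by push_cast; ring, Complex.norm_exp_ofReal]

/-- Half of the Gaussian exponent absorbs the exponential: completing the square costs the factor
`exp (c²s²)`. -/
theorem memLp_exp_norm_mul_targetWave (γ : ℝ) {s : ℝ} (hs : 0 < s) (M : ℕ) (c : ℝ) :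
    MemLp (fun x : Conf M => Real.exp (c * ‖x‖) * ‖targetWave γ s M x‖) 2 := by
  have hcont : Continuous (targetWave γ s M) := (targetSchwartz γ hs M).continuous
  have h1 : MemLp (fun x : Conf M => Real.exp (-(4 * s ^ 2)⁻¹ * ‖x‖ ^ 2)) 2 := by
    rw [memLp_two_iff_integrable_sq (by fun_prop)]
    have := integrable_exp_neg_mul_norm_sq (V := Conf M) (b := 2 * (4 * s ^ 2)⁻¹) (by positivity)
    refine this.congr (Eventually.of_forall fun x => ?_)
    dsimp only
    rw [← Real.exp_nat_mul]
    congr 1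
    push_cast
    ring
  refine (h1.const_mul (((√s * Real.pi ^ (1 / 4 : ℝ))⁻¹) ^ M * Real.exp (c ^ 2 * s ^ 2))).mono
    (by fun_prop) (Eventually.of_forall fun x => ?_)
  have hA : 0 ≤ ((√s * Real.pi ^ (1 / 4 : ℝ))⁻¹) ^ M := by positivity
  rw [Real.norm_of_nonneg (by positivity), Real.norm_of_nonneg (by positivity),
    norm_targetWave γ hs, mul_left_comm, mul_assoc, ← Real.exp_add, ← Real.exp_add]
  refine mul_le_mul_of_nonneg_left (Real.exp_le_exp.2 ?_) hA
  have h2 : c ^ 2 * s ^ 2 + -(4 * s ^ 2)⁻¹ * ‖x‖ ^ 2 - (c * ‖x‖ + -(2 * s ^ 2)⁻¹ * ‖x‖ ^ 2) =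
      (c * s - ‖x‖ / (2 * s)) ^ 2 := by
    field_simp
    ring
  nlinarith [sq_nonneg (c * s - ‖x‖ / (2 * s))]

/-- `lowering` as a linear map. -/
noncomputable abbrev loweringLM (γ s : ℝ) (k : Fin M) : TestSpace M →ₗ[ℂ] TestSpace M :=
  (lowering γ s k : Op M).toLinearMap

/-- `raising` as a linear map. -/
noncomputable abbrev raisingLM (γ s : ℝ) (k : Fin M) : TestSpace M →ₗ[ℂ] TestSpace M :=
  (raising γ s k : Op M).toLinearMap

/-- The excitations of the target state. -/
noncomputable abbrev targetExcitations (γ : ℝ) {s : ℝ} (hs : 0 < s) (M n : ℕ) :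
    Submodule ℂ (TestSpace M) :=
  excitationSpace (raisingLM γ s)
    (targetSchwartz γ hs M) n

theorem X_eq_lowering_add_raising (γ : ℝ) {s : ℝ} (hs : 0 < s) (k : Fin M) :
    (X k : Op M) = ((s / √2 : ℝ) : ℂ) • (lowering γ s k + raising γ s k) := by
  have hs' : (s : ℂ) ≠ 0 := by exact_mod_cast hs.ne'
  have h2 := ofReal_sqrt_two_sq
  unfold lowering raising
  push_cast
  match_scalars
  · field_simp
    rw [h2]
    ring
  · ring

theorem lowering_raising_apply (γ : ℝ) {s : ℝ} (hs : 0 < s) (k l : Fin M) (v : TestSpace M) :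
    lowering γ s k (raising γ s l v) =
      raising γ s l (lowering γ s k v) + if k = l then v else 0 := by
  have h := congrArg (fun T : Op M => T v) (lowering_mul_raising γ hs.ne' k l)
  simp only [mul_apply_eq_comp, add_apply, smul_apply, one_apply_eq_self] at h
  rw [h]
  split_ifs <;> simp

theorem X_mem_targetExcitations (γ : ℝ) {s : ℝ} (hs : 0 < s) (k : Fin M) (n : ℕ)
    {v : TestSpace M} (hv : v ∈ targetExcitations γ hs M n) :
    X k v ∈ targetExcitations γ hs M (n + 1) := by
  rw [X_eq_lowering_add_raising γ hs, smul_apply, add_apply]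
  refine Submodule.smul_mem _ _ (add_mem ?_ ?_)
  · exact excitationSpace_mono _ _ (Nat.le_succ n)
      (lowering_mem_excitationSpace
        (a := loweringLM γ s)
        (lowering_raising_apply γ hs) (lowering_targetSchwartz γ hs) k n v hv)
  · exact raising_mem_excitationSpace _ _ k n v hv

/-- Position is a combination of lowering and raising. Powers of linear forms are all that the
series of `e^{i⟨t, x⟩}` requires. -/
theorem exists_excitation_eq_inner_pow_mul (γ : ℝ) {s : ℝ} (hs : 0 < s) (t : Conf M) (n : ℕ) :
    ∃ v ∈ targetExcitations γ hs M n,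
      ∀ x, v x = ((inner ℝ t x : ℝ) : ℂ) ^ n * targetWave γ s M x := by
  induction n with
  | zero =>
    exact ⟨targetSchwartz γ hs M,
      Submodule.mem_span_singleton_self (targetSchwartz γ hs M), fun x => by
      rw [pow_zero, one_mul, targetSchwartz_apply]⟩
  | succ n ih =>
    obtain ⟨v, hv, hvx⟩ := ih
    refine ⟨∑ k, (t k : ℂ) • X k v, Submodule.sum_mem _ fun k _ => Submodule.smul_mem _ _
      (X_mem_targetExcitations γ hs k n hv), fun x => ?_⟩
    have h : ((inner ℝ t x : ℝ) : ℂ) = ∑ k, (t k : ℂ) * (x k : ℂ) := by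
      rw [PiLp.inner_apply]
      push_cast
      refine Finset.sum_congr rfl fun k _ => ?_
      rw [RCLike.inner_apply, conj_trivial]
      push_cast
      ring
    rw [sum_apply]
    simp only [smul_apply, X_apply, hvx, smul_eq_mul]
    rw [pow_succ, h, mul_comm _ (∑ k, _), mul_assoc, Finset.sum_mul]
    exact Finset.sum_congr rfl fun k _ => by ring

theorem eq_zero_of_orthogonal_targetExcitations (γ : ℝ) {s : ℝ} (hs : 0 < s) (f : ModeSpace M)
    (hf : ∀ n, ∀ v ∈ targetExcitations γ hs M n, ⟪f, ket v⟫_ℂ = 0) : f = 0 := by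
  have hcont : Continuous (targetWave γ s M) := (targetSchwartz γ hs M).continuous
  have hfm : AEStronglyMeasurable f volume := (Lp.memLp f).1
  let h : Conf M → ℂ := fun x => starRingEnd ℂ (f x) * targetWave γ s M x
  have hhm : AEStronglyMeasurable h volume :=
    (RCLike.continuous_conj.comp_aestronglyMeasurable hfm).mul hcont.aestronglyMeasurable
  have hexp : ∀ c : ℝ, Integrable fun x => Real.exp (c * ‖x‖) * ‖h x‖ := by
    intro c
    have := (memLp_exp_norm_mul_targetWave γ hs M c).integrable_mul (Lp.memLp f).norm
    refine this.congr (Eventually.of_forall fun x => ?_)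
    simp only [h, Pi.mul_apply, norm_mul, RCLike.norm_conj]
    ring
  have hh : Integrable h := by
    have := hexp 0
    simp only [zero_mul, Real.exp_zero, one_mul] at this
    exact (integrable_norm_iff hhm).1 this
  have hpow : ∀ (t : Conf M) (n : ℕ), ∫ x, ((inner ℝ t x : ℝ) : ℂ) ^ n * h x = 0 := by
    intro t n
    obtain ⟨v, hv, hvx⟩ := exists_excitation_eq_inner_pow_mul γ hs t n
    rw [← hf n v hv, inner_ket_right]
    congr 1 with x
    simp only [h, hvx]
    ring
  have hchar : ∀ t : Conf M, ∫ x, Complex.exp (Complex.I * (inner ℝ t x : ℝ)) * h x = 0 := by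
    intro t
    -- The dominating series sums to `e^{‖t‖‖x‖} ‖h x‖`, integrable by `hexp`.
    have hsum := hasSum_integral_of_dominated_convergence (μ := (volume : Measure (Conf M)))
      (F := fun (n : ℕ) x => (Complex.I * (inner ℝ t x : ℝ)) ^ n / n.factorial * h x)
      (f := fun x => Complex.exp (Complex.I * (inner ℝ t x : ℝ)) * h x)
      (fun n x => (‖t‖ * ‖x‖) ^ n / n.factorial * ‖h x‖)
      (fun n => (Continuous.aestronglyMeasurable (by fun_prop)).mul hhm)
      (fun n => Eventually.of_forall fun x => by
        rw [norm_mul, norm_div, norm_pow, norm_mul, Complex.norm_I, one_mul, Complex.norm_real,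
          Complex.norm_natCast]
        gcongr
        exact norm_inner_le_norm t x)
      (Eventually.of_forall fun x => (Real.summable_pow_div_factorial _).mul_right _)
      ((hexp ‖t‖).congr (Eventually.of_forall fun x => by
        dsimp only
        rw [tsum_mul_right, Real.exp_eq_exp_ℝ, NormedSpace.exp_eq_tsum_div]))
      (Eventually.of_forall fun x => by
        refine HasSum.mul_right _ ?_
        rw [Complex.exp_eq_exp_ℂ]
        exact NormedSpace.expSeries_div_hasSum_exp _)
    have hz : ∀ n : ℕ, ∫ x, (Complex.I * (inner ℝ t x : ℝ)) ^ n / n.factorial * h x = 0 := by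
      intro n
      have e : ∀ x, (Complex.I * (inner ℝ t x : ℝ)) ^ n / n.factorial * h x =
          (Complex.I ^ n / n.factorial) * (((inner ℝ t x : ℝ) : ℂ) ^ n * h x) := by
        intro x; rw [mul_pow]; ring
      simp_rw [e]
      rw [integral_const_mul, hpow, mul_zero]
    simp only [hz] at hsum
    exact hsum.unique hasSum_zero
  rw [Lp.eq_zero_iff_ae_eq_zero]
  filter_upwards [ae_eq_zero_of_forall_integral_cexp_inner_eq_zero hh hchar] with x hx
  have hne : targetWave γ s M x ≠ 0 := by
    rw [← norm_ne_zero_iff, norm_targetWave γ hs]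
    positivity
  simpa [h, hne] using hx

theorem targetExcitations_dense (γ : ℝ) {s : ℝ} (hs : 0 < s) (M : ℕ) :
    (⨆ n, (targetExcitations γ hs M n).map
      (ketCLM M : TestSpace M →ₗ[ℂ] ModeSpace M)).topologicalClosure = ⊤ := by
  rw [Submodule.topologicalClosure_eq_top_iff, eq_bot_iff]
  intro f hf
  refine (Submodule.mem_bot ℂ).2 (eq_zero_of_orthogonal_targetExcitations γ hs f fun n v hv => ?_)
  exact (Submodule.mem_orthogonal' _ _).1 hf _
    (Submodule.mem_iSup_of_mem n (Submodule.mem_map_of_mem hv))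

/-! ### The operator inequality and its extension to the closed form -/

/-- The operator inequality `W ≤ |ψ⟩⟨ψ|` on Schwartz space. -/
theorem inner_witness_le (γ : ℝ) {s : ℝ} (hs : 0 < s) (η : TestSpace M) :
    (⟪ket η, ket (witness γ s M η)⟫_ℂ).re ≤ ‖⟪targetVec γ hs M, ket η⟫_ℂ‖ ^ 2 := by
  have h := norm_sq_le_vacuum_add_number
    (a := loweringLM γ s)
    (b := raisingLM γ s)
    (ψ := targetSchwartz γ hs M) (ket := (ketCLM M : TestSpace M →ₗ[ℂ] ModeSpace M))
    (fun k v w => isFormalAdjoint_lowering γ s k v w) (lowering_raising_apply γ hs)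
    (fun k l v => congrArg (fun T : Op M => T v) (raising_commute γ s k l).eq)
    (lowering_targetSchwartz γ hs) (norm_targetVec γ hs M) (targetExcitations_dense γ hs M) η
  have e : witness γ s M η = η - numberOp
      (loweringLM γ s)
      (raisingLM γ s) η := by
    rw [witness_eq γ hs.ne']
    simp [numberOp, sum_apply]
  rw [e, ← ketCLM_apply, ← ketCLM_apply, map_sub, inner_sub_right, Complex.sub_re,
    inner_self_eq_norm_sq_to_K]
  have e2 : (((‖ketCLM M η‖ : ℝ) : ℂ) ^ 2).re = ‖ketCLM M η‖ ^ 2 := by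
    rw [← Complex.ofReal_pow, Complex.ofReal_re]
  change _ ≤ ‖⟪ketCLM M (targetSchwartz γ hs M), ketCLM M η⟫_ℂ‖ ^ 2
  simp only [ContinuousLinearMap.coe_coe] at h
  refine le_trans (sub_le_sub_right e2.le _) ?_
  linarith

theorem formValue_witness_le (γ : ℝ) {s : ℝ} (hs : 0 < s) (φ : ModeSpace M) :
    formValue (witness γ s M) φ ≤ ((‖⟪targetVec γ hs M, φ⟫_ℂ‖ ^ 2 : ℝ) : EReal) := by
  -- Density of Schwartz space makes the filter nontrivial, so the limsup of the continuous upper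
  -- bound is its value at `φ`.
  have : (comap (ket : TestSpace M → ModeSpace M) (𝓝 φ)).NeBot :=
    comap_neBot fun t ht => (denseRange_ket.mem_nhds ht)
  have hlim : Tendsto (fun η : TestSpace M =>
      ((‖⟪targetVec γ hs M, ket η⟫_ℂ‖ ^ 2 : ℝ) : EReal)) (comap ket (𝓝 φ))
      (𝓝 ((‖⟪targetVec γ hs M, φ⟫_ℂ‖ ^ 2 : ℝ) : EReal)) := by
    have hc : Continuous fun ξ : ModeSpace M =>
        ((‖⟪targetVec γ hs M, ξ⟫_ℂ‖ ^ 2 : ℝ) : EReal) :=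
      continuous_coe_real_ereal.comp (by fun_prop)
    exact (hc.tendsto φ).comp tendsto_comap
  rw [formValue, ← hlim.limsup_eq]
  exact limsup_le_limsup (Eventually.of_forall fun η =>
    EReal.coe_le_coe_iff.2 (inner_witness_le γ hs η))

/-- The vector `η` itself lies over every neighbourhood of `ket η`, so its value occurs frequently.
-/
theorem inner_le_formValue_ket (W : Op M) (η : TestSpace M) :
    (((⟪ket η, ket (W η)⟫_ℂ).re : ℝ) : EReal) ≤ formValue W (ket η) := by
  refine le_limsup_of_frequently_le' ?_
  rw [frequently_comap]
  exact (frequently_nhds_iff.2 fun U hU _ => ⟨ket η, hU, η, rfl, le_rfl⟩)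

theorem witness_targetSchwartz (γ : ℝ) {s : ℝ} (hs : 0 < s) (M : ℕ) :
    witness γ s M (targetSchwartz γ hs M) = targetSchwartz γ hs M := by
  rw [witness_eq γ hs.ne']
  simp [sum_apply, lowering_targetSchwartz]

theorem formValue_witness_smul_targetVec (γ : ℝ) {s : ℝ} (hs : 0 < s) (c : ℂ) :
    formValue (witness γ s M) (c • targetVec γ hs M) = ((‖c‖ ^ 2 : ℝ) : EReal) := by
  refine le_antisymm ?_ ?_
  · refine (formValue_witness_le γ hs _).trans_eq ?_
    simp [inner_smul_right, inner_self_eq_norm_sq_to_K, norm_targetVec γ hs]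
  · have h := inner_le_formValue_ket (witness γ s M) (c • targetSchwartz γ hs M)
    have e : ket (c • targetSchwartz γ hs M) = c • targetVec γ hs M := by
      rw [← ketCLM_apply, map_smul]
      rfl
    rw [map_smul, witness_targetSchwartz, e, inner_self_eq_norm_sq_to_K, norm_smul,
      norm_targetVec γ hs, mul_one, ← RCLike.ofReal_pow] at h
    exact h

/-! ### Traces, fidelity and expectation values -/

section Trace

variable {H : Type*} [NormedAddCommGroup H] [InnerProductSpace ℂ H] {ι : Type*}

/-- Parseval's identity. -/
theorem hasSum_norm_sq_inner (e : HilbertBasis ι ℂ H) (v : H) :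
    HasSum (fun i => ‖⟪v, e i⟫_ℂ‖ ^ 2) (‖v‖ ^ 2) := by
  have h := e.hasSum_inner_mul_inner v v
  have h2 : ∀ i, ⟪v, e i⟫_ℂ * ⟪e i, v⟫_ℂ = ((‖⟪v, e i⟫_ℂ‖ ^ 2 : ℝ) : ℂ) := fun i => by
    rw [← inner_conj_symm (e i) v, Complex.mul_conj']
    push_cast
    rfl
  have h3 : ⟪v, v⟫_ℂ = ((‖v‖ ^ 2 : ℝ) : ℂ) := by
    rw [inner_self_eq_norm_sq_to_K]; push_cast; rfl
  simp only [h2, h3] at h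
  exact Complex.hasSum_ofReal.1 h

theorem tsum_ofReal_norm_sq_inner (e : HilbertBasis ι ℂ H) (v : H) :
    ∑' i, ENNReal.ofReal (‖⟪v, e i⟫_ℂ‖ ^ 2) = ENNReal.ofReal (‖v‖ ^ 2) := by
  have h := hasSum_norm_sq_inner e v
  rw [← h.tsum_eq, ENNReal.ofReal_tsum_of_nonneg (fun _ => by positivity) h.summable]

variable [CompleteSpace H]

theorem opSqrt_isSelfAdjoint (ρ : H →L[ℂ] H) : IsSelfAdjoint (opSqrt ρ) :=
  (CFC.sqrt_nonneg ρ).isSelfAdjoint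

theorem inner_opSqrt_apply (ρ : H →L[ℂ] H) (v w : H) :
    ⟪v, opSqrt ρ w⟫_ℂ = ⟪opSqrt ρ v, w⟫_ℂ :=
  ((opSqrt_isSelfAdjoint ρ).isSymmetric v w).symm

theorem norm_opSqrt_apply_sq {ρ : H →L[ℂ] H} (hρ : ρ.IsPositive) (v : H) :
    ‖opSqrt ρ v‖ ^ 2 = (⟪v, ρ v⟫_ℂ).re := by
  have h := CFC.sqrt_mul_sqrt_self ρ ((ContinuousLinearMap.nonneg_iff_isPositive ρ).2 hρ)
  have h2 : ⟪v, ρ v⟫_ℂ = ⟪opSqrt ρ v, opSqrt ρ v⟫_ℂ := by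
    rw [← inner_opSqrt_apply]
    conv_lhs => rw [← h]
    rfl
  rw [h2, inner_self_eq_norm_sq_to_K, ← RCLike.ofReal_pow]
  rfl

theorem opSqrt_rankOne_self {v : H} (hv : ‖v‖ = 1) :
    opSqrt (InnerProductSpace.rankOne ℂ v v) = InnerProductSpace.rankOne ℂ v v :=
  CFC.sqrt_unique (InnerProductSpace.isIdempotentElem_rankOne_self hv)
    ((ContinuousLinearMap.nonneg_iff_isPositive _).2
      (InnerProductSpace.isPositive_rankOne_self v))

end Trace

theorem toENNReal_coe_real (r : ℝ) : (r : EReal).toENNReal = ENNReal.ofReal r := by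
  rw [EReal.toENNReal_of_ne_top (EReal.coe_ne_top _), EReal.toReal_coe]

variable {ι : Type*}

theorem fidelity_rankOne_self (e : HilbertBasis ι ℂ (ModeSpace M)) (v : ModeSpace M)
    {ρ : ModeSpace M →L[ℂ] ModeSpace M} (hρ : ρ.IsPositive) :
    fidelity e (InnerProductSpace.rankOne ℂ v v) ρ = ‖opSqrt ρ v‖ ^ 2 := by
  have h : ∀ i, ⟪e i, InnerProductSpace.rankOne ℂ v v (ρ (e i))⟫_ℂ =
      ⟪ρ v, e i⟫_ℂ * ⟪e i, v⟫_ℂ := fun i => by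
    rw [InnerProductSpace.rankOne_apply, inner_smul_right]
    congr 1
    exact (hρ.isSelfAdjoint.isSymmetric v (e i)).symm
  rw [fidelity, norm_opSqrt_apply_sq hρ]
  simp_rw [h]
  rw [e.tsum_inner_mul_inner]
  exact congrArg Complex.re (hρ.isSelfAdjoint.isSymmetric v v)

theorem isDensityOperator_rankOne_self (e : HilbertBasis ι ℂ (ModeSpace M)) {v : ModeSpace M}
    (hv : ‖v‖ = 1) : IsDensityOperator e (InnerProductSpace.rankOne ℂ v v) := by
  refine ⟨InnerProductSpace.isPositive_rankOne_self v, ?_⟩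
  have h := e.hasSum_inner_mul_inner v v
  rw [inner_self_eq_norm_sq_to_K, hv] at h
  simpa [inner_smul_right] using h

/-- Self-adjointness of `ρ^{1/2}` turns `|⟨ψ, ρ^{1/2}e_i⟩|²` into a Parseval coefficient of
`ρ^{1/2}ψ`, so the positive parts sum to at most the fidelity; the subtracted negative parts only
lower the value. -/
theorem expectation_witness_le (γ : ℝ) {s : ℝ} (hs : 0 < s) (e : HilbertBasis ι ℂ (ModeSpace M))
    {ρ : ModeSpace M →L[ℂ] ModeSpace M} (hρ : ρ.IsPositive) :
    expectation e (witness γ s M) ρ ≤ ((fidelity e (target γ hs M) ρ : ℝ) : EReal) := by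
  have h1 : ∑' i, (formValue (witness γ s M) (opSqrt ρ (e i))).toENNReal ≤
      ENNReal.ofReal (‖opSqrt ρ (targetVec γ hs M)‖ ^ 2) := by
    rw [← tsum_ofReal_norm_sq_inner e]
    refine ENNReal.tsum_le_tsum fun i => ?_
    rw [← inner_opSqrt_apply, ← toENNReal_coe_real]
    exact EReal.toENNReal_le_toENNReal (formValue_witness_le γ hs _)
  rw [target, fidelity_rankOne_self e _ hρ, expectation]
  refine (EReal.sub_le_sub (EReal.coe_ennreal_le_coe_ennreal_iff.2 h1)
    (EReal.coe_ennreal_nonneg _)).trans_eq ?_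
  rw [sub_zero, EReal.coe_ennreal_ofReal, max_eq_left (by positivity)]

theorem expectation_witness_target (γ : ℝ) {s : ℝ} (hs : 0 < s)
    (e : HilbertBasis ι ℂ (ModeSpace M)) :
    expectation e (witness γ s M) (target γ hs M) = 1 := by
  have hv := norm_targetVec γ hs M
  have h : ∀ i, formValue (witness γ s M) (opSqrt (target γ hs M) (e i)) =
      ((‖⟪targetVec γ hs M, e i⟫_ℂ‖ ^ 2 : ℝ) : EReal) := fun i => by
    rw [target, opSqrt_rankOne_self hv, InnerProductSpace.rankOne_apply,
      formValue_witness_smul_targetVec]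
  have hneg : ∀ i, (-((‖⟪targetVec γ hs M, e i⟫_ℂ‖ ^ 2 : ℝ) : EReal)).toENNReal = 0 := fun i => by
    rw [← EReal.coe_neg, toENNReal_coe_real]
    exact ENNReal.ofReal_of_nonpos (neg_nonpos.2 (by positivity))
  simp only [expectation, h, hneg, toENNReal_coe_real, tsum_zero, tsum_ofReal_norm_sq_inner e, hv]
  simp

end CVWitness

theorem lemma2 (M : ℕ) (γ s : ℝ) (hs : 0 < s)
    {ι : Type*} (e : HilbertBasis ι ℂ (CVWitness.ModeSpace M)) :
    CVWitness.IsDensityOperator e (CVWitness.target γ hs M) ∧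
    CVWitness.IsFidelityWitness e (CVWitness.target γ hs M) (CVWitness.witness γ s M) ∧
    CVWitness.fidelity e (CVWitness.target γ hs M) (CVWitness.target γ hs M) = 1 ∧
    CVWitness.HomodyneMeasurable (6 * M) 4 4 (CVWitness.witness γ s M) := by
  have hv := CVWitness.norm_targetVec γ hs M
  refine ⟨CVWitness.isDensityOperator_rankOne_self e hv,
    ⟨CVWitness.witness_isHermitian γ hs.ne' M,
      fun ρ hρ => CVWitness.expectation_witness_le γ hs e hρ.1,
      CVWitness.expectation_witness_target γ hs e⟩, ?_,
    CVWitness.witness_homodyneMeasurable γ s M⟩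
  rw [CVWitness.target, CVWitness.fidelity_rankOne_self e _
    (InnerProductSpace.isPositive_rankOne_self _), CVWitness.opSqrt_rankOne_self hv,
    InnerProductSpace.rankOne_apply, inner_self_eq_norm_sq_to_K, hv]
  simp [hv]
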